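/- Consider a mixture of two partially ionized monatomic gases A and B with constants $0<\beta\le 1$ (fraction of atoms of type A), $0<T_A<T_B\le 2T_A$ (ionization temperatures), $\mu_A,\mu_B>0$ (Saha constants), $R>0$ (universal gas constant), $M_A,M_B>0$ (molar masses), and $M=\beta M_A+(1-\beta)M_B$. The thermodynamic states are the pairs $(T,\alpha_A)$ with $T>0$, $0<\alpha_A<1$, and $$\alpha_B=\frac{\mu_A\alpha_Ae^{-(T_B-T_A)/T}}{\mu_A\alpha_Ae^{-(T_B-T_A)/T}+\mu_B(1-\alpha_A)},\qquad \alpha=\beta\alpha_A+(1-\beta)\alpha_B,$$ $$p=\frac{(1-\alpha_A)(1+\alpha)}{\mu_A\alpha_A\alpha}T^{5/2}e^{-T_A/T},\qquad v=\frac{RT(1+\alpha)}{Mp},$$ $$e=\frac{5RT}{2M}(1+\alpha)+\frac RM\left[\beta T_A\alpha_A+(1-\beta)T_B\alpha_B\right]-pv.$$ The Lagrangian equations $v_t-u_\xi=0$, $u_t+p_\xi=0$, $(e+\frac12u^2)_t+(pu)_\xi=0$ have a positive and a negative characteristic speed $\lambda_\pm$, with characteristic vector fields $\boldsymbol r_\pm$.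 The genuinely nonlinear region is the set of all $(T,\alpha_A)$ at which $\boldsymbol r_+\nabla\lambda_+\neq0$ and $\boldsymbol r_-\nabla\lambda_-\neq0$ (for every flow velocity $u$). For a laboratory state $(p_+,T_+)$ with $p_+,T_+>0$, the approximate thermodynamic Hugoniot locus is the set of all $(T,\alpha_A)$ with $$\frac{T}{T_+}(1+\alpha)(4+\Pi)+\frac{2\left[\beta T_A\alpha_A+(1-\beta)T_B\alpha_B\right]}{T_+}=4+\frac1\Pi,$$ $$\Pi=\frac{p_+}{p}=\frac{\alpha_A\alpha}{(1-\alpha_A)(1+\alpha)\hat L_+^2}\left(\frac{T_+}{T}\right)^{5/2}e^{T_A/T},\qquad \hat L_+^2=\frac{T_+^{5/2}}{\mu_Ap_+}.$$ Let $0<\sigma<60$. Then there is a $\delta>0$, depending only on $\sigma$ and on the constants of the mixture, such that the following holds for all $p_+>0$ and all $0<T_+\le T$ for which $$\sqrt{\frac{\beta T_+T_A^{3/2}}{\mu_Ap_+}}\left(\frac T{T_A}\right)^{-9/4}e^{-T_A/(2T)}\le\sigma:$$ every point $(T,\alpha_A)$ of the approximate thermodynamic Hugoniot locus of $(p_+,T_+)$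 with $\alpha_A<\delta$ and $\alpha_B<\delta$ lies in the genuinely nonlinear region. -/

import Mathlib

open Filter Topology

noncomputable section

/-- A mixture of two monatomic gases A and B in thermal equilibrium: the fraction `β` of atoms of
type A, the first ionization temperatures, the constants `μ_A, μ_B` of Saha's laws, the universal
gas constant and the molar masses. -/
structure IonizedMixture where
  β : ℝ
  TA : ℝ
  TB : ℝ
  μA : ℝ
  μB : ℝ
  R : ℝ
  MA : ℝ
  MB : ℝ
  β_pos : 0 < β
  β_le_one : β ≤ 1
  TA_pos : 0 < TA
  TA_lt_TB : TA < TB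
  TB_le : TB ≤ 2 * TA
  μA_pos : 0 < μA
  μB_pos : 0 < μB
  R_pos : 0 < R
  MA_pos : 0 < MA
  MB_pos : 0 < MB

namespace IonizedMixture

variable (G : IonizedMixture)

/-- The molar mass of the mixture. -/
def M : ℝ := G.β * G.MA + (1 - G.β) * G.MB

/-- The degree of ionization of B, as a function of the temperature `T` and of the degree of
ionization `a` of A, determined by the compatibility of the two Saha laws
(see `compatibility` below). -/
def alphaB (T a : ℝ) : ℝ :=
  G.μA * a * Real.exp (-(G.TB - G.TA) / T) /
    (G.μA * a * Real.exp (-(G.TB - G.TA) / T) + G.μB * (1 - a))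

/-- The total degree of ionization `α = β α_A + (1 - β) α_B`. -/
def alpha (T a : ℝ) : ℝ := G.β * a + (1 - G.β) * G.alphaB T a

/-- The pressure, given by Saha's law for the gas A. -/
def p (T a : ℝ) : ℝ :=
  (1 - a) * (1 + G.alpha T a) / (G.μA * a * G.alpha T a) *
    T ^ (5 / 2 : ℝ) * Real.exp (-G.TA / T)

/-- The specific volume, given by the equation of state `p v = (R / M) T (1 + α)`. -/
def v (T a : ℝ) : ℝ := G.R / G.M * T * (1 + G.alpha T a) / G.p T a

/-- The specific enthalpy. -/
def enthalpy (T a : ℝ) : ℝ :=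
  5 * G.R * T / (2 * G.M) * (1 + G.alpha T a) +
    G.R / G.M * (G.β * G.TA * a + (1 - G.β) * G.TB * G.alphaB T a)

/-- The specific internal energy `e = h - p v`. -/
def e (T a : ℝ) : ℝ := G.enthalpy T a - G.p T a * G.v T a

/-- The compatibility condition of the two Saha laws. -/
theorem compatibility {T a : ℝ} (ha : 0 < a) (ha' : a < 1) :
    (1 / a - 1) * (Real.exp (-G.TA / T) / G.μA) =
      (1 / G.alphaB T a - 1) * (Real.exp (-G.TB / T) / G.μB) := by
  have hA := G.μA_pos
  have hB := G.μB_pos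
  have h1 : 0 < 1 - a := sub_pos.2 ha'
  have hx := Real.exp_pos (-(G.TB - G.TA) / T)
  have hE : Real.exp (-G.TB / T) = Real.exp (-(G.TB - G.TA) / T) * Real.exp (-G.TA / T) := by
    rw [← Real.exp_add]
    congr 1
    ring
  rw [hE, alphaB]
  field_simp
  ring

/-- Saha's law for the gas B gives the same pressure. -/
theorem p_eq_sahaB {T a : ℝ} (ha : 0 < a) (ha' : a < 1) :
    G.p T a = (1 - G.alphaB T a) * (1 + G.alpha T a) / (G.μB * G.alphaB T a * G.alpha T a) *
      T ^ (5 / 2 : ℝ) * Real.exp (-G.TB / T) := by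
  have hb : G.alphaB T a ≠ 0 := by
    have := G.μA_pos
    have := G.μB_pos
    have h1 : 0 < 1 - a := sub_pos.2 ha'
    unfold alphaB
    positivity
  have hA := G.μA_pos.ne'
  have hB := G.μB_pos.ne'
  have h := G.compatibility (T := T) ha ha'
  have h2 : (1 - a) / (G.μA * a) * Real.exp (-G.TA / T) =
      (1 - G.alphaB T a) / (G.μB * G.alphaB T a) * Real.exp (-G.TB / T) := by
    have e1 : (1 / a - 1) * (Real.exp (-G.TA / T) / G.μA) =
        (1 - a) / (G.μA * a) * Real.exp (-G.TA / T) := by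
      field_simp
    have e2 : (1 / G.alphaB T a - 1) * (Real.exp (-G.TB / T) / G.μB) =
        (1 - G.alphaB T a) / (G.μB * G.alphaB T a) * Real.exp (-G.TB / T) := by
      field_simp
    rw [← e1, ← e2, h]
  calc G.p T a = ((1 - a) / (G.μA * a) * Real.exp (-G.TA / T)) *
        ((1 + G.alpha T a) / G.alpha T a * T ^ (5 / 2 : ℝ)) := by
        unfold p
        rw [← div_mul_div_comm]
        ring
    _ = _ := by
        rw [h2, ← div_mul_div_comm]
        ring

/-- The conserved quantities `(v, u, e + u² / 2)` of the Lagrangian equations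
`v_t - u_ξ = 0`, `u_t + p_ξ = 0`, `(e + u² / 2)_t + (p u)_ξ = 0`, as functions of the state
`(T, α_A, u)`. -/
def density (w : ℝ × ℝ × ℝ) : ℝ × ℝ × ℝ :=
  (G.v w.1 w.2.1, w.2.2, G.e w.1 w.2.1 + w.2.2 ^ 2 / 2)

/-- The fluxes `(-u, p, p u)` of the Lagrangian equations. -/
def flux (w : ℝ × ℝ × ℝ) : ℝ × ℝ × ℝ :=
  (-w.2.2, G.p w.1 w.2.1, G.p w.1 w.2.1 * w.2.2)

/-- Near the state `w`, `lam` is a characteristic speed of the system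
`density_t + flux_ξ = 0` with characteristic vector field `r`; both are `C¹` at `w`. -/
def IsCharacteristicFieldAt (lam : ℝ × ℝ × ℝ → ℝ) (r : ℝ × ℝ × ℝ → ℝ × ℝ × ℝ)
    (w : ℝ × ℝ × ℝ) : Prop :=
  ContDiffAt ℝ 1 lam w ∧ ContDiffAt ℝ 1 r w ∧
    ∀ᶠ z in 𝓝 w, r z ≠ 0 ∧
      fderiv ℝ G.flux z (r z) = lam z • fderiv ℝ G.density z (r z)

/-- The forward characteristic field (the one with positive Lagrangian speed `λ₊`) is genuinely
nonlinear at `w`: `r₊ ∇λ₊ ≠ 0`. The positive characteristic speed is unique and simple, so that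
`r₊` is determined up to a non-vanishing factor. -/
def ForwardGenuinelyNonlinearAt (w : ℝ × ℝ × ℝ) : Prop :=
  ∃ (lam : ℝ × ℝ × ℝ → ℝ) (r : ℝ × ℝ × ℝ → ℝ × ℝ × ℝ),
    G.IsCharacteristicFieldAt lam r w ∧ 0 < lam w ∧ fderiv ℝ lam w (r w) ≠ 0

/-- The backward characteristic field (the one with negative Lagrangian speed `λ₋`) is genuinely
nonlinear at `w`: `r₋ ∇λ₋ ≠ 0`. -/
def BackwardGenuinelyNonlinearAt (w : ℝ × ℝ × ℝ) : Prop :=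
  ∃ (lam : ℝ × ℝ × ℝ → ℝ) (r : ℝ × ℝ × ℝ → ℝ × ℝ × ℝ),
    G.IsCharacteristicFieldAt lam r w ∧ lam w < 0 ∧ fderiv ℝ lam w (r w) ≠ 0

/-- The genuinely nonlinear region in the `(T, α_A)`-plane: the states at which both the forward
and the backward characteristic fields are genuinely nonlinear, for every flow velocity `u`. -/
def genuinelyNonlinearRegion : Set (ℝ × ℝ) :=
  {s | 0 < s.1 ∧ 0 < s.2 ∧ s.2 < 1 ∧ ∀ u : ℝ,
    G.ForwardGenuinelyNonlinearAt (s.1, s.2, u) ∧ G.BackwardGenuinelyNonlinearAt (s.1, s.2, u)}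

/-- The approximate pressure ratio `p₊ / p`, where `L̂₊² = T₊^{5/2} / (μ_A p₊)`. -/
def pressureRatio (pR TR T a : ℝ) : ℝ :=
  a * G.alpha T a / ((1 - a) * (1 + G.alpha T a) * (TR ^ (5 / 2 : ℝ) / (G.μA * pR))) *
    (TR / T) ^ (5 / 2 : ℝ) * Real.exp (G.TA / T)

/-- The approximate thermodynamic Hugoniot locus of the laboratory state `(p₊, T₊) = (pR, TR)`,
as a set of states `(T, α_A)`: the thermodynamic Rankine-Hugoniot condition in which the degrees
of ionization of the right state are put equal to `0`. -/
def approxHugoniot (pR TR : ℝ) : Set (ℝ × ℝ) :=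
  {s | 0 < s.1 ∧ 0 < s.2 ∧ s.2 < 1 ∧
    s.1 / TR * (1 + G.alpha s.1 s.2) * (4 + G.pressureRatio pR TR s.1 s.2) +
        2 * (G.β * G.TA * s.2 + (1 - G.β) * G.TB * G.alphaB s.1 s.2) / TR =
      4 + (G.pressureRatio pR TR s.1 s.2)⁻¹}

end IonizedMixture

end

/-! ### Elementary estimates and the threshold for positivity -/

noncomputable section

/-! Along an isentrope parametrized by `log T`, let `r` and `q` be the logarithmic derivatives of
`p` and `1 / v`. Then `λ² = p r / (v q)`, so the logarithmic derivative of `λ²` is `r + q + r' / r -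
q' / q`. The characteristic fields are tangent to isentropes, and this number has to be nonzero.

For weak ionization `r ≈ 5/2`, `q ≈ 3/2`, and `r'`, `q'` share the leading term `f = β a (1 - a) τ
Y²`, where `τ = T_A / T` and `Y` is the derivative of the logit of `a`. The number is then close to
`4 - 4 f / 15`, positive as long as `f < 15` (`logDeriv_pos`). Since `|Y|` is at most about `τ / 2`,
`f` is at most about `β a τ³ / 4`; this is where the bound 60 comes from.

On the approximate Hugoniot locus `T ≥ T₊` forces `Π T / T₊ ≤ 1`. Combined with Saha's law, the
hypothesis on `σ` becomes `β a τ³ ≤ σ (1 + α)` (`cube_le_of_mem_approxHugoniot`), which stays below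
60 once `α` is small.

The difficulty is uniformity as `T → 0`. With `α_A, α_B < δ` the moments `α τ^k`, `k ≤ 2`, can be
made small, but `β a τ³` is only bounded, so every error term must be a third moment times a further
small factor. Gas B contributes no third moment because `α_B` carries the factor `exp (-(T_B - T_A)
/ T)`. The error terms are collected in `WeakIonization.bounds`. -/

theorem abs_mul_le_mul {u v U V : ℝ} (hu : |u| ≤ U) (hv : |v| ≤ V) : |u * v| ≤ U * V := by
  rw [abs_mul]
  exact mul_le_mul hu hv (abs_nonneg _) ((abs_nonneg _).trans hu)

theorem abs_weighted_le {A B x u v V : ℝ} (hA : 0 ≤ A) (hB : 0 ≤ B) (hAB : A + B ≤ x)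
    (hu : |u| ≤ V) (hv : |v| ≤ V) : |A * u + B * v| ≤ V * x := by
  have hV : 0 ≤ V := (abs_nonneg _).trans hu
  have h1 : |A * u| ≤ A * V := by rw [abs_mul, abs_of_nonneg hA]; gcongr
  have h2 : |B * v| ≤ B * V := by rw [abs_mul, abs_of_nonneg hB]; gcongr
  calc |A * u + B * v| ≤ |A * u| + |B * v| := abs_add_le _ _
    _ ≤ V * (A + B) := by linarith
    _ ≤ V * x := by gcongr

/-- The derivative of `log lam²` along an isentrope is positive as soon as the logarithmic
derivatives `r, q` of `p, 1 / v` are close to `5 / 2, 3 / 2` and their own derivatives are close to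
a common value `f < 15`. -/
theorem logDeriv_pos {f r q r' q' η : ℝ} (hf0 : 0 ≤ f) (hη : 0 < η) (hη1 : η ≤ 1 / 1000000)
    (hf : f ≤ 15 - 50000 * η)
    (hr : |r - 5 / 2| ≤ 20 * η) (hq : |q - 3 / 2| ≤ 20 * η)
    (hr' : |r' - f| ≤ 10000 * η) (hq' : |q' - f| ≤ 10000 * η) :
    0 < r + q + r' / r - q' / q := by
  rw [abs_le] at hr hq hr' hq'
  have hr0 : 0 < r := by linarith
  have hq0 : 0 < q := by linarith
  -- At `r = 5/2`, `q = 3/2`, `r' = q' = f` the numerator is `4 · 15/4 - f (r - q) = 15 - f`.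
  have h1 : r + q + r' / r - q' / q = ((r + q) * (r * q) + r' * q - q' * r) / (r * q) := by
    field_simp
  rw [h1]
  refine div_pos ?_ (mul_pos hr0 hq0)
  have h2 : 15 - 600 * η ≤ (r + q) * (r * q) := by
    have e1 : 15 / 4 - 80 * η ≤ r * q := by nlinarith
    have e2 : 4 - 40 * η ≤ r + q := by linarith
    nlinarith
  have h3 : (f - 10000 * η) * q ≤ r' * q := by
    apply mul_le_mul_of_nonneg_right _ hq0.le; linarith
  have h4 : q' * r ≤ (f + 10000 * η) * r := by
    apply mul_le_mul_of_nonneg_right _ hr0.le; linarith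
  have h5 : f * (r - q - 1) ≤ f * (40 * η) := by
    apply mul_le_mul_of_nonneg_left _ hf0; linarith
  have h6 : f * (40 * η) ≤ 15 * (40 * η) := by
    apply mul_le_mul_of_nonneg_right _ (by positivity); linarith
  have h7 : 10000 * η * (r + q) ≤ 10000 * η * (41 / 10) := by
    apply mul_le_mul_of_nonneg_left _ (by positivity); linarith
  -- The errors add up to `(600 + 600 + 41000) η`, below the margin `50000 η` left in `hf`.
  nlinarith

/-! ### Weak ionization: the slope of the isentrope -/

/-- The regime of weak ionization: `P = β a` and `Q = (1 - β) b` are the contributions of the two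
gases to the total degree of ionization, `τ` and `κ` are the ionization temperatures divided by
the temperature. -/
structure WeakIonization (η P Q a b τ κ : ℝ) : Prop where
  η_pos : 0 < η
  η_le : η ≤ 1 / 1000000
  P_pos : 0 < P
  Q_nonneg : 0 ≤ Q
  a_pos : 0 < a
  b_pos : 0 < b
  τ_pos : 0 < τ
  τ_le : τ ≤ κ
  κ_le : κ ≤ 2 * τ
  a_le : a ≤ η
  b_le : b ≤ η
  zeroth : P + Q ≤ η
  first : (P + Q) * τ ≤ η
  second : (P + Q) * τ ^ 2 ≤ η
  -- The only moment that is bounded without being small; it carries the leading term `f`.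
  third : P * τ ^ 3 ≤ 60
  Q_third : Q * τ ^ 3 ≤ η

namespace WeakIonization

variable {η P Q a b τ κ : ℝ}

theorem x_third (h : WeakIonization η P Q a b τ κ) : (P + Q) * τ ^ 3 ≤ 61 := by
  have := h.third
  have := h.Q_third
  have := h.η_le
  nlinarith

theorem A_nonneg (h : WeakIonization η P Q a b τ κ) : 0 ≤ P * (1 - a) :=
  mul_nonneg h.P_pos.le (by linarith [h.a_le, h.η_le])

theorem B_nonneg (h : WeakIonization η P Q a b τ κ) : 0 ≤ Q * (1 - b) :=
  mul_nonneg h.Q_nonneg (by linarith [h.b_le, h.η_le])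

theorem A_le (h : WeakIonization η P Q a b τ κ) : P * (1 - a) ≤ P := by
  nlinarith [h.P_pos, h.a_pos]

theorem B_le (h : WeakIonization η P Q a b τ κ) : Q * (1 - b) ≤ Q := by
  nlinarith [h.Q_nonneg, h.b_pos]

theorem A_add_B_le (h : WeakIonization η P Q a b τ κ) :
    P * (1 - a) + Q * (1 - b) ≤ P + Q := add_le_add h.A_le h.B_le

/-- To leading order `den = A + B + x ≈ 2 x` and `Y * den ≈ τ x - B (κ - τ)`. Since `B ≤ x` and `0 ≤
κ - τ ≤ τ`, the latter lies between `0` and `τ x`, so `Y` lies approximately between `0` and `τ /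
2`. No smallness of `B` relative to `A` is needed. -/
theorem abs_Y_le (h : WeakIonization η P Q a b τ κ) {A B x Y den : ℝ} (hA : A = P * (1 - a))
    (hB : B = Q * (1 - b)) (hx : x = P + Q)
    (hden : den = (1 + 5 / 2 * x) * (A + B) + x * (A * τ + B * κ) + x * (1 + x))
    (hY : Y * den = τ * (x * (1 + x)) - (1 + 5 / 2 * x) * (B * (κ - τ)) -
      x * (B * κ * (κ - τ))) : |Y| ≤ (1 / 2 + 10 * η) * τ := by
  have hη := h.η_pos
  have hη' := h.η_le
  have hτ := h.τ_pos
  have hκ : 0 < κ := hτ.trans_le h.τ_le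
  have hA0 : 0 ≤ A := hA ▸ h.A_nonneg
  have hB0 : 0 ≤ B := hB ▸ h.B_nonneg
  have hx0 : 0 < x := hx ▸ add_pos_of_pos_of_nonneg h.P_pos h.Q_nonneg
  have hxη : x ≤ η := hx ▸ h.zeroth
  have hxτ : x * τ ≤ η := hx ▸ h.first
  have hBx : B ≤ x := by rw [hB, hx]; linarith [h.B_le, h.P_pos]
  have hAB : x * (1 - η) ≤ A + B := by
    rw [hA, hB, hx]
    nlinarith [mul_le_mul_of_nonneg_left h.a_le h.P_pos.le,
      mul_le_mul_of_nonneg_left h.b_le h.Q_nonneg]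
  have hd1 : 0 ≤ x * (A * τ + B * κ) := by positivity
  have hd2 : 0 ≤ x * (A + B) := by positivity
  have hx2 : 0 < x * x := by positivity
  have hxη' : x * η ≤ x * (1 / 1000000) := by gcongr
  have hden2 : x * (2 - η) ≤ den := by linarith
  have hdenx : x ≤ den := by linarith
  have hden0 : 0 < den := hx0.trans_le hdenx
  have hk : 0 ≤ κ - τ := sub_nonneg.2 h.τ_le
  have hk' : κ - τ ≤ τ := by linarith [h.κ_le]
  rw [abs_le]
  constructor
  · have e1 : B * (κ - τ) ≤ x * τ := mul_le_mul hBx hk' hk hx0.le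
    have e2 : B * κ * (κ - τ) ≤ x * (2 * τ) * τ :=
      mul_le_mul (mul_le_mul hBx h.κ_le hκ.le hx0.le) hk' hk (by positivity)
    have e3 : (1 + 5 / 2 * x) * (B * (κ - τ)) ≤ (1 + 5 / 2 * x) * (x * τ) := by gcongr
    have e4 : x * (B * κ * (κ - τ)) ≤ x * (x * (2 * τ) * τ) := by gcongr
    have e5 : x * τ * (2 * (x * τ)) ≤ x * τ * (2 * η) := by gcongr
    have e6 : x * τ * x ≤ x * τ * η := by gcongr
    have e7 : 0 < x * τ := by positivity
    have e8 : -(1 / 2 * τ * den) ≤ Y * den := by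
      have f1 : τ * x ≤ τ * den := by gcongr
      have f2 : x * τ * η ≤ x * τ * (1 / 1000000) := by gcongr
      linarith
    have e9 : -(1 / 2 * τ) ≤ Y := by
      refine le_of_mul_le_mul_right ?_ hden0
      linarith
    have e10 : 0 < η * τ := by positivity
    linarith
  · have e1 : 0 ≤ (1 + 5 / 2 * x) * (B * (κ - τ)) := by positivity
    have e2 : 0 ≤ x * (B * κ * (κ - τ)) := by positivity
    have e3 : τ * x * x ≤ τ * x * η := by gcongr
    have e4 : (1 / 2 + 10 * η) * τ * (x * (2 - η)) ≤ (1 / 2 + 10 * η) * τ * den := by gcongr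
    have e5 : 0 < τ * x := by positivity
    have f1 : τ * x * η * η ≤ τ * x * η * (1 / 1000000) := by gcongr
    have f2 : 0 < τ * x * η := by positivity
    have e6 : Y * den ≤ (1 / 2 + 10 * η) * τ * den := by linarith
    exact le_of_mul_le_mul_right e6 hden0

/-- To leading order, `Y = g` where the degree of ionization of the second gas is negligible. -/
theorem abs_A_mul_Y_sub_g_le (h : WeakIonization η P Q a b τ κ) {A B x Y g den : ℝ}
    (hA : A = P * (1 - a)) (hB : B = Q * (1 - b)) (hx : x = P + Q)
    (hden : den = (1 + 5 / 2 * x) * (A + B) + x * (A * τ + B * κ) + x * (1 + x))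
    (hYg : (Y - g) * den = τ * (P * a + Q) - 5 / 2 * x * (τ * A) -
      (1 + 5 / 2 * x) * (B * (2 * κ - τ)) - x * (A * τ ^ 2 + B * κ * (2 * κ - τ)) + τ * x ^ 2) :
    τ ^ 2 * |A * (Y - g)| ≤ 700 * η := by
  have hη := h.η_pos
  have hη' := h.η_le
  have hτ := h.τ_pos
  have hτκ := h.τ_le
  have hκ2 := h.κ_le
  have hQ := h.Q_nonneg
  have hP := h.P_pos
  have ha := h.a_pos
  have hκ : 0 < κ := hτ.trans_le h.τ_le
  have hA0 : 0 ≤ A := hA ▸ h.A_nonneg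
  have hB0 : 0 ≤ B := hB ▸ h.B_nonneg
  have hx0 : 0 < x := hx ▸ add_pos_of_pos_of_nonneg h.P_pos h.Q_nonneg
  have hxη : x ≤ η := hx ▸ h.zeroth
  have hxτ : x * τ ≤ η := hx ▸ h.first
  have hx3 : x * τ ^ 3 ≤ 61 := hx ▸ h.x_third
  have hBQ : B ≤ Q := hB ▸ h.B_le
  have hABx : A + B ≤ x := by rw [hA, hB, hx]; exact h.A_add_B_le
  have hPx : P ≤ x := by linarith
  have hd1 : 0 ≤ x * (A * τ + B * κ) := by positivity
  have hd2 : 0 ≤ x * (A + B) := by positivity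
  have hx2 : 0 < x * x := by positivity
  have hdenx : x ≤ den := by linarith
  have hk0 : 0 ≤ 2 * κ - τ := by linarith
  have hk3 : 2 * κ - τ ≤ 3 * τ := by linarith
  -- The leading parts of `τ * den` and `2 * (g * den)` cancel up to `τ (x - A) = τ (P a + Q)`. What
  -- is left is quadratic in the degrees of ionization or belongs to gas B.
  have hnum : |(Y - g) * den| ≤ τ * (x * a + 5 * Q + 4 * x ^ 2 + 6 * x ^ 2 * τ) := by
    have e1 : B * (2 * κ - τ) ≤ Q * (3 * τ) := mul_le_mul hBQ hk3 hk0 hQ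
    have e2 : (1 + 5 / 2 * x) * (B * (2 * κ - τ)) ≤ (1 + 5 / 2 * η) * (Q * (3 * τ)) := by gcongr
    have e3 : B * κ * (2 * κ - τ) ≤ B * (2 * τ) * (3 * τ) := by gcongr
    have e4 : x * (A * τ ^ 2 + B * κ * (2 * κ - τ)) ≤ x * (6 * (x * τ ^ 2)) := by
      gcongr
      have g1 : (A + B) * τ ^ 2 ≤ x * τ ^ 2 := by gcongr
      have g2 : 0 ≤ A * τ ^ 2 := by positivity
      linarith
    have e5 : P * a ≤ x * a := by gcongr
    have e6 : x * (τ * A) ≤ x * (τ * x) := by gcongr; linarith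
    have f1 : 0 ≤ (1 + 5 / 2 * x) * (B * (2 * κ - τ)) := by positivity
    have f2 : 0 ≤ x * (A * τ ^ 2 + B * κ * (2 * κ - τ)) := by positivity
    have f3 : 0 ≤ τ * (P * a + Q) := by positivity
    have f4 : 0 ≤ x * (τ * A) := by positivity
    have f5 : τ * (P * a) ≤ τ * (x * a) := by gcongr
    have f6 : 0 ≤ τ * Q := by positivity
    have f7 : η * (τ * Q) ≤ 1 / 1000000 * (τ * Q) := by gcongr
    have f8 : 0 ≤ τ * (x * a) := by positivity
    have f9 : 0 ≤ τ * x ^ 2 := by positivity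
    have f10 : 0 ≤ τ * (x ^ 2 * τ) := by positivity
    rw [hYg, abs_le]
    constructor <;> linarith
  -- Since `A ≤ x ≤ den`, the factor `A` makes division by `den` unnecessary.
  have hxYg : |A * (Y - g)| ≤ |(Y - g) * den| := by
    rw [mul_comm, abs_mul, abs_mul, abs_of_nonneg hA0, abs_of_pos (hx0.trans_le hdenx)]
    gcongr
    linarith
  calc τ ^ 2 * |A * (Y - g)|
      ≤ τ ^ 2 * (τ * (x * a + 5 * Q + 4 * x ^ 2 + 6 * x ^ 2 * τ)) := by
        gcongr
        exact hxYg.trans hnum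
    _ = x * τ ^ 3 * a + 5 * (Q * τ ^ 3) + 4 * (x * τ ^ 3 * x) + 6 * (x * τ ^ 3 * (x * τ)) := by
        ring
    _ ≤ 61 * η + 5 * η + 4 * (61 * η) + 6 * (61 * η) := by
        have := h.a_le
        have := h.Q_third
        gcongr
    _ ≤ 700 * η := by linarith

end WeakIonization

/-! ### Weak ionization: second derivatives along the isentrope -/

namespace WeakIonization

variable {η P Q a b τ κ : ℝ}

theorem moments_le (h : WeakIonization η P Q a b τ κ) {A B x : ℝ}
    (hA : A = P * (1 - a)) (hB : B = Q * (1 - b)) (hx : x = P + Q) :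
    (0 ≤ A * τ + B * κ ∧ A * τ + B * κ ≤ 2 * (x * τ)) ∧
      (0 ≤ A * τ ^ 2 + B * κ ^ 2 ∧ A * τ ^ 2 + B * κ ^ 2 ≤ 4 * (x * τ ^ 2)) := by
  have hτ := h.τ_pos
  have hκ : 0 < κ := hτ.trans_le h.τ_le
  have hA0 : 0 ≤ A := hA ▸ h.A_nonneg
  have hB0 : 0 ≤ B := hB ▸ h.B_nonneg
  have hABx : A + B ≤ x := by rw [hA, hB, hx]; exact h.A_add_B_le
  have hκ2 := h.κ_le
  refine ⟨⟨by positivity, ?_⟩, ⟨by positivity, ?_⟩⟩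
  · have e1 : B * κ ≤ B * (2 * τ) := by gcongr
    have e2 : (A + B) * τ ≤ x * τ := by gcongr
    have e3 : 0 ≤ A * τ := by positivity
    linarith
  · have e1 : B * κ ^ 2 ≤ B * (2 * τ) ^ 2 := by gcongr
    have e2 : (A + B) * τ ^ 2 ≤ x * τ ^ 2 := by gcongr
    have e3 : 0 ≤ A * τ ^ 2 := by positivity
    linarith

theorem abs_one_sub_two_mul_sq_le {a Y V : ℝ} (ha : 0 ≤ a) (ha' : a ≤ 1) (hY : |Y| ≤ V) :
    |(1 - 2 * a) * Y ^ 2| ≤ V ^ 2 := by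
  have h1 : |1 - 2 * a| ≤ 1 := by rw [abs_le]; constructor <;> linarith
  have h2 : |Y ^ 2| ≤ V ^ 2 := by rw [abs_pow]; gcongr
  simpa using abs_mul_le_mul h1 h2

set_option maxHeartbeats 1600000 in
/-- Bounds for the derivatives along an isentrope, in terms of the derivatives `Y`, `Z` of the
logits of the degrees of ionization and of the derivative `g'` of `g = τ - Y = κ - Z`. -/
theorem bounds (h : WeakIonization η P Q a b τ κ) {A B x Y Z g g' den m1 m2 dx F S S1 : ℝ}
    (hA : A = P * (1 - a)) (hB : B = Q * (1 - b)) (hx : x = P + Q)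
    (hY : Y = τ - g) (hZ : Z = κ - g)
    (hm1 : m1 = A * τ + B * κ) (hm2 : m2 = A * τ ^ 2 + B * κ ^ 2)
    (hden : den = (1 + 5 / 2 * x) * (A + B) + x * m1 + x * (1 + x))
    (hg : g * den = (1 + 5 / 2 * x) * m1 + x * m2)
    (hdx : dx = A * Y + B * Z) (hF : F = A * τ * Y + B * κ * Z)
    (hS : S = A * ((1 - 2 * a) * Y ^ 2) + B * ((1 - 2 * b) * Z ^ 2))
    (hS1 : S1 = A * (τ * ((1 - 2 * a) * Y ^ 2)) + B * (κ * ((1 - 2 * b) * Z ^ 2)))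
    (hg' : g' * den = (1 + 5 / 2 * x) * (S - m1) + 5 / 2 * dx ^ 2 + dx * F +
      x * (S1 - F - m2) - g * dx * (1 + 2 * x)) :
    |dx| ≤ 2 * η ∧ |F| ≤ 4 * η ∧ |S - m1 - g' * (A + B)| ≤ 540 * η ∧
      |S1 - F - m2 - g' * m1 - A * τ * Y ^ 2| ≤ 8600 * η ∧
      |Y| ≤ (1 / 2 + 10 * η) * τ := by
  have hη := h.η_pos
  have hη' := h.η_le
  have hτ := h.τ_pos
  have hτκ := h.τ_le
  have hκ2 := h.κ_le
  have hQ := h.Q_nonneg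
  have hP := h.P_pos
  have ha := h.a_pos
  have hb := h.b_pos
  have ha' := h.a_le
  have hb' := h.b_le
  have hQ3 := h.Q_third
  have hκ : 0 < κ := hτ.trans_le h.τ_le
  have hA0 : 0 ≤ A := hA ▸ h.A_nonneg
  have hB0 : 0 ≤ B := hB ▸ h.B_nonneg
  have hx0 : 0 < x := hx ▸ add_pos_of_pos_of_nonneg h.P_pos h.Q_nonneg
  have hxη : x ≤ η := hx ▸ h.zeroth
  have hx1 : x * τ ≤ η := hx ▸ h.first
  have hx2 : x * τ ^ 2 ≤ η := hx ▸ h.second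
  have hx3 : x * τ ^ 3 ≤ 61 := hx ▸ h.x_third
  have hBQ : B ≤ Q := hB ▸ h.B_le
  have hABx : A + B ≤ x := by rw [hA, hB, hx]; exact h.A_add_B_le
  obtain ⟨⟨hm1n, hm1le⟩, ⟨hm2n, hm2le⟩⟩ := h.moments_le hA hB hx
  rw [← hm1] at hm1n hm1le
  rw [← hm2] at hm2n hm2le
  have hxx : 0 < x * x := by positivity
  have hxm : 0 ≤ x * m1 := by positivity
  have hxAB : 0 ≤ x * (A + B) := by positivity
  have hdenx : x ≤ den := by linarith
  have hden0 : 0 < den := hx0.trans_le hdenx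
  have hYle : |Y| ≤ (1 / 2 + 10 * η) * τ := by
    refine h.abs_Y_le hA hB hx (hm1 ▸ hden) ?_
    calc Y * den = τ * den - g * den := by rw [hY]; ring
      _ = _ := by rw [hg, hden, hm2, hm1]; ring
  have hYτ : |Y| ≤ τ := by
    have h1 : (1 / 2 + 10 * η) * τ ≤ 1 * τ := by gcongr; linarith
    linarith
  -- From above, `Z = κ - g ≤ κ` as `g ≥ 0`; from below, `Z = Y + (κ - τ) ≥ Y`.
  have hZτ : |Z| ≤ 2 * τ := by
    have h1 : (1 / 2 + 10 * η) * τ ≤ 3 / 4 * τ := by gcongr; linarith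
    have hg0 : 0 ≤ g := by
      refine nonneg_of_mul_nonneg_left ?_ hden0
      rw [hg]; positivity
    have hYlow := (abs_le.1 hYle).1
    rw [abs_le]
    constructor <;> linarith
  have hg2 : |g| ≤ 2 * τ := by
    have hYlow := abs_le.1 hYτ
    rw [abs_le]
    constructor <;> linarith
  have hYg : τ ^ 2 * |A * (Y - g)| ≤ 700 * η := by
    refine h.abs_A_mul_Y_sub_g_le hA hB hx (hm1 ▸ hden) ?_
    calc (Y - g) * den = τ * den - 2 * (g * den) := by rw [hY]; ring
      _ = τ * (x - A) - 5 / 2 * x * (τ * A) - (1 + 5 / 2 * x) * (B * (2 * κ - τ)) -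
          x * (A * τ ^ 2 + B * κ * (2 * κ - τ)) + τ * x ^ 2 := by
        rw [hg, hden, hm2, hm1]; ring
      _ = _ := by
        have : x - A = P * a + Q := by rw [hx, hA]; ring
        rw [this]
  have hdxle : |dx| ≤ 2 * (x * τ) := by
    rw [hdx]
    refine (abs_weighted_le hA0 hB0 hABx (hYτ.trans (by linarith)) hZτ).trans (by linarith)
  have hFle : |F| ≤ 4 * (x * τ ^ 2) := by
    rw [hF, mul_assoc, mul_assoc]
    have h1 : |τ * Y| ≤ 4 * τ ^ 2 := by
      refine (abs_mul_le_mul (abs_of_pos hτ).le hYτ).trans ?_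
      linarith [sq_nonneg τ]
    have h2 : |κ * Z| ≤ 4 * τ ^ 2 := by
      refine (abs_mul_le_mul ((abs_of_pos hκ).le.trans hκ2) hZτ).trans (le_of_eq (by ring))
    refine (abs_weighted_le hA0 hB0 hABx h1 h2).trans (by linarith)
  have hY2 : |(1 - 2 * a) * Y ^ 2| ≤ τ ^ 2 :=
    abs_one_sub_two_mul_sq_le ha.le (by linarith) hYτ
  have hZ2 : |(1 - 2 * b) * Z ^ 2| ≤ (2 * τ) ^ 2 :=
    abs_one_sub_two_mul_sq_le hb.le (by linarith) hZτ
  have hSle : |S| ≤ 4 * (x * τ ^ 2) := by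
    rw [hS]
    refine (abs_weighted_le hA0 hB0 hABx (V := 4 * τ ^ 2) (hY2.trans ?_)
      (hZ2.trans (le_of_eq (by ring)))).trans (by linarith)
    linarith [sq_nonneg τ]
  have hτ3 : 0 < τ ^ 3 := by positivity
  have hκZ : |κ * ((1 - 2 * b) * Z ^ 2)| ≤ 8 * τ ^ 3 :=
    (abs_mul_le_mul ((abs_of_pos hκ).le.trans hκ2) hZ2).trans (le_of_eq (by ring))
  have hS1le : |S1| ≤ 8 * (x * τ ^ 3) := by
    rw [hS1]
    refine (abs_weighted_le hA0 hB0 hABx (V := 8 * τ ^ 3) ?_ hκZ).trans (by linarith)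
    refine (abs_mul_le_mul (abs_of_pos hτ).le hY2).trans ?_
    linarith [show τ * τ ^ 2 = τ ^ 3 by ring]
  have hxabs : |x| ≤ η := by rwa [abs_of_pos hx0]
  have hm1abs : |m1| ≤ 2 * (x * τ) := by rwa [abs_of_nonneg hm1n]
  have hm2abs : |m2| ≤ 4 * (x * τ ^ 2) := by rwa [abs_of_nonneg hm2n]
  have hsmall : ∀ u : ℝ, |u| ≤ η → |1 + 5 / 2 * u| ≤ 2 := fun u hu => by
    rw [abs_le] at hu ⊢
    constructor <;> linarith
  have hx12 : |1 + 2 * x| ≤ 2 := by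
    rw [abs_of_pos (by linarith)]; linarith
  -- products of two small factors
  have hdx2 : |dx ^ 2| ≤ 4 * (x * (x * τ ^ 2)) := by
    rw [sq]; exact (abs_mul_le_mul hdxle hdxle).trans (le_of_eq (by ring))
  have hdxF : |dx * F| ≤ 8 * (x * (x * τ ^ 3)) :=
    (abs_mul_le_mul hdxle hFle).trans (le_of_eq (by ring))
  have hgdx : |g * dx| ≤ 4 * (x * τ ^ 2) :=
    (abs_mul_le_mul hg2 hdxle).trans (le_of_eq (by ring))
  have hSF : |S1 - F - m2| ≤ 8 * (x * τ ^ 3) + 8 * (x * τ ^ 2) := by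
    have h1 := abs_sub (S1 - F) m2
    have h2 := abs_sub S1 F
    linarith
  have hxSF : |x * (S1 - F - m2)| ≤ η * (8 * 61 + 8 * η) :=
    abs_mul_le_mul hxabs (hSF.trans (by gcongr))
  have hηη : η * η ≤ η * (1 / 1000000) := by gcongr
  -- the right-hand side of the equation for `g'`
  have hE : x * |g'| ≤ 520 * η := by
    have h0 : x * |g'| ≤ |g' * den| := by
      rw [abs_mul, abs_of_pos hden0, mul_comm]; gcongr
    have h1 : |(1 + 5 / 2 * x) * (S - m1)| ≤ 2 * (6 * η) := by
      refine abs_mul_le_mul (hsmall x hxabs) ?_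
      have := abs_sub S m1
      linarith
    have h2 : |dx ^ 2| ≤ 4 * (η * η) := hdx2.trans (by gcongr)
    have h3 : |dx * F| ≤ 8 * (η * η) := by
      calc |dx * F| ≤ 8 * (x * (x * τ ^ 3)) := hdxF
        _ = 8 * ((x * τ) * (x * τ ^ 2)) := by ring
        _ ≤ _ := by gcongr
    have h4 : |g * dx * (1 + 2 * x)| ≤ 4 * η * 2 :=
      abs_mul_le_mul (hgdx.trans (by linarith)) hx12
    rw [hg'] at h0
    rw [abs_le] at h1 h2 h3 h4 hxSF
    refine h0.trans ?_
    rw [abs_le]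
    constructor <;> linarith
  -- One more power of `τ` than in `hE`. Term by term `τ S` and `τ g dx` are only of the size of `x
  -- τ ^ 3`, which is not small. Their difference contains `A (Y - g) Y`, and the cancellation in `Y
  -- - g` provides the missing factor.
  have hτE : τ * (x * |g'|) ≤ 4200 * η := by
    have hSg : τ * |S - g * dx| ≤ 850 * η := by
      have e0 : S - g * dx = A * (Y - g) * Y + (-(2 * a)) * (A * Y ^ 2) +
          B * ((1 - 2 * b) * Z ^ 2 - g * Z) := by rw [hS, hdx]; ring
      have e1 : |A * (Y - g) * Y| ≤ |A * (Y - g)| * τ := abs_mul_le_mul le_rfl hYτ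
      have e2 : |(-(2 * a)) * (A * Y ^ 2)| ≤ 2 * η * (x * τ ^ 2) := by
        refine abs_mul_le_mul ?_ ?_
        · rw [abs_neg, abs_of_pos (by linarith)]; linarith
        · refine abs_mul_le_mul ?_ ?_
          · rw [abs_of_nonneg hA0]; linarith
          · rw [abs_pow]; gcongr
      have e3 : |B * ((1 - 2 * b) * Z ^ 2 - g * Z)| ≤ Q * (8 * τ ^ 2) := by
        refine abs_mul_le_mul (by rwa [abs_of_nonneg hB0]) ?_
        have f1 : |g * Z| ≤ 2 * τ * (2 * τ) := abs_mul_le_mul hg2 hZτ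
        have f2 := abs_sub ((1 - 2 * b) * Z ^ 2) (g * Z)
        linarith
      have e4 : |S - g * dx| ≤ |A * (Y - g)| * τ + 2 * η * (x * τ ^ 2) + Q * (8 * τ ^ 2) := by
        rw [e0]
        refine (abs_add_le _ _).trans (add_le_add ((abs_add_le _ _).trans ?_) e3)
        exact add_le_add e1 e2
      calc τ * |S - g * dx|
          ≤ τ * (|A * (Y - g)| * τ + 2 * η * (x * τ ^ 2) + Q * (8 * τ ^ 2)) := by gcongr
        _ = τ ^ 2 * |A * (Y - g)| + 2 * η * (x * τ ^ 3) + 8 * (Q * τ ^ 3) := by ring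
        _ ≤ 700 * η + 2 * η * 61 + 8 * η := by gcongr
        _ ≤ 850 * η := by linarith
    have h0 : x * |g'| ≤ |g' * den| := by
      rw [abs_mul, abs_of_pos hden0, mul_comm]; gcongr
    have e0 : g' * den = (S - g * dx) + 5 / 2 * (x * S) - (1 + 5 / 2 * x) * m1 +
        5 / 2 * dx ^ 2 + dx * F + x * (S1 - F - m2) - 2 * (x * (g * dx)) := by rw [hg']; ring
    have h1 : |x * S| ≤ x * (4 * (x * τ ^ 2)) :=
      abs_mul_le_mul (abs_of_pos hx0).le hSle
    have h2 : |(1 + 5 / 2 * x) * m1| ≤ 2 * (2 * (x * τ)) :=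
      abs_mul_le_mul (hsmall x hxabs) hm1abs
    have h3 : |x * (S1 - F - m2)| ≤ x * (8 * (x * τ ^ 3) + 8 * (x * τ ^ 2)) :=
      abs_mul_le_mul (abs_of_pos hx0).le hSF
    have h4 : |x * (g * dx)| ≤ x * (4 * (x * τ ^ 2)) :=
      abs_mul_le_mul (abs_of_pos hx0).le hgdx
    have h5 : |g' * den| ≤ |S - g * dx| + 4 * (x * τ) + 36 * (x * (x * τ ^ 2)) +
        16 * (x * (x * τ ^ 3)) := by
      have h6 := neg_abs_le (S - g * dx)
      have h7 := le_abs_self (S - g * dx)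
      rw [e0]
      rw [abs_le] at h1 h2 h3 h4 hdx2 hdxF ⊢
      constructor <;> linarith
    calc τ * (x * |g'|) ≤ τ * (|S - g * dx| + 4 * (x * τ) + 36 * (x * (x * τ ^ 2)) +
        16 * (x * (x * τ ^ 3))) := by gcongr; exact h0.trans h5
      _ = τ * |S - g * dx| + 4 * (x * τ ^ 2) + 36 * (x * (x * τ ^ 3)) +
        16 * (x * τ * (x * τ ^ 3)) := by ring
      _ ≤ 850 * η + 4 * η + 36 * (η * 61) + 16 * (η * 61) := by gcongr
      _ ≤ 4200 * η := by linarith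
  refine ⟨hdxle.trans (by linarith), hFle.trans (by linarith), ?_, ?_, hYle⟩
  · have h1 : |g' * (A + B)| ≤ 520 * η := by
      rw [abs_mul, abs_of_nonneg (add_nonneg hA0 hB0), mul_comm]
      exact le_trans (by gcongr) hE
    rw [abs_le] at h1 hSle hm1abs ⊢
    constructor <;> linarith
  · have h1 : |g' * m1| ≤ 8400 * η := by
      rw [abs_mul, abs_of_nonneg hm1n]
      calc |g'| * m1 ≤ |g'| * (2 * (x * τ)) := by gcongr
        _ = 2 * (τ * (x * |g'|)) := by ring
        _ ≤ 2 * (4200 * η) := by gcongr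
        _ = 8400 * η := by ring
    -- Only the gas A part of `S1`, without the correction `-2 a`, survives as leading term.
    have h2 : |S1 - A * τ * Y ^ 2| ≤ 130 * η := by
      have e0 : S1 - A * τ * Y ^ 2 = (-(2 * a)) * (A * τ * Y ^ 2) +
          B * (κ * ((1 - 2 * b) * Z ^ 2)) := by rw [hS1]; ring
      have e2 : |(-(2 * a)) * (A * τ * Y ^ 2)| ≤ 2 * η * (x * τ * τ ^ 2) := by
        refine abs_mul_le_mul ?_ ?_
        · rw [abs_neg, abs_of_pos (by linarith)]; linarith
        · refine abs_mul_le_mul ?_ ?_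
          · rw [abs_of_nonneg (by positivity)]; gcongr; linarith
          · rw [abs_pow]; gcongr
      have e3 : |B * (κ * ((1 - 2 * b) * Z ^ 2))| ≤ Q * (8 * τ ^ 3) :=
        abs_mul_le_mul (by rwa [abs_of_nonneg hB0]) hκZ
      have e4 : 2 * η * (x * τ * τ ^ 2) ≤ 2 * η * 61 := by
        rw [show x * τ * τ ^ 2 = x * τ ^ 3 by ring]; gcongr
      rw [e0]
      rw [abs_le] at e2 e3 ⊢
      constructor <;> linarith
    rw [abs_le] at h1 h2 hFle hm2abs ⊢
    constructor <;> linarith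

end WeakIonization

/-! Quantities along an isentrope, parametrized by `log T`, of a mixture with degrees of
ionization `a, b` and with ionization temperatures `τ, κ` in units of the temperature. -/

namespace Isentrope

/-- The total degree of ionization. -/
def deg (β a b : ℝ) : ℝ := β * a + (1 - β) * b

/-- The weight `a (1 - a)` is the derivative of `a` with respect to its logit. With logit
derivatives `τ - g`, `κ - g`, derivatives of sums over the gases become `mom1 - g mom0` and `mom2 -
g mom1`. -/
def mom0 (β a b : ℝ) : ℝ := β * a * (1 - a) + (1 - β) * b * (1 - b)

def mom1 (β a b τ κ : ℝ) : ℝ := β * a * (1 - a) * τ + (1 - β) * b * (1 - b) * κ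

def mom2 (β a b τ κ : ℝ) : ℝ := β * a * (1 - a) * τ ^ 2 + (1 - β) * b * (1 - b) * κ ^ 2

def slopeDen (β a b τ κ : ℝ) : ℝ :=
  (1 + 5 / 2 * deg β a b) * mom0 β a b + deg β a b * mom1 β a b τ κ +
    deg β a b * (1 + deg β a b)

/-- The number `g` such that the logits of `a` and `b` have the derivatives `τ - g` and `κ - g`
with respect to `log T`. -/
def slope (β a b τ κ : ℝ) : ℝ :=
  ((1 + 5 / 2 * deg β a b) * mom1 β a b τ κ + deg β a b * mom2 β a b τ κ) / slopeDen β a b τ κ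

/-- The derivative of `deg` with respect to `log T`. -/
def dDeg (β a b τ κ : ℝ) : ℝ := mom1 β a b τ κ - slope β a b τ κ * mom0 β a b

/-- The derivative of the ionization energy with respect to `log T`, in units of `R T / M`. -/
def dHeat (β a b τ κ : ℝ) : ℝ := mom2 β a b τ κ - slope β a b τ κ * mom1 β a b τ κ

/-- The derivative of `log p` with respect to `log T`. -/
def dLogP (β a b τ κ : ℝ) : ℝ :=
  5 / 2 + (5 / 2 * dDeg β a b τ κ + dHeat β a b τ κ) / (1 + deg β a b)

/-- The derivative of `-log v` with respect to `log T`. -/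
def dLogRho (β a b τ κ : ℝ) : ℝ :=
  3 / 2 + (3 / 2 * dDeg β a b τ κ + dHeat β a b τ κ) / (1 + deg β a b)

/-- `sq1` and `sq2` are the parts quadratic in the logit derivatives when `dDeg` and `dHeat` are
differentiated: the weight `a (1 - a)` has derivative `a (1 - a) (1 - 2 a) (τ - g)`. -/
def sq1 (β a b τ κ : ℝ) : ℝ :=
  β * a * (1 - a) * ((1 - 2 * a) * (τ - slope β a b τ κ) ^ 2) +
    (1 - β) * b * (1 - b) * ((1 - 2 * b) * (κ - slope β a b τ κ) ^ 2)

def sq2 (β a b τ κ : ℝ) : ℝ :=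
  β * a * (1 - a) * (τ * ((1 - 2 * a) * (τ - slope β a b τ κ) ^ 2)) +
    (1 - β) * b * (1 - b) * (κ * ((1 - 2 * b) * (κ - slope β a b τ κ) ^ 2))

theorem deg_pos {β a b : ℝ} (hβ : 0 < β) (hβ1 : β ≤ 1) (ha : 0 < a) (hb : 0 < b) :
    0 < deg β a b :=
  add_pos_of_pos_of_nonneg (mul_pos hβ ha) (mul_nonneg (sub_nonneg.2 hβ1) hb.le)

theorem slopeDen_pos {β a b τ κ : ℝ} (hβ : 0 < β) (hβ1 : β ≤ 1) (ha : 0 < a) (ha1 : a < 1)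
    (hb : 0 < b) (hb1 : b < 1) (hτ : 0 < τ) (hκ : 0 < κ) : 0 < slopeDen β a b τ κ := by
  have h1 : 0 ≤ 1 - β := sub_nonneg.2 hβ1
  have h2 : 0 < 1 - a := sub_pos.2 ha1
  have h3 : 0 < 1 - b := sub_pos.2 hb1
  have hx := deg_pos hβ hβ1 ha hb
  have hm0 : 0 ≤ mom0 β a b := by unfold mom0; positivity
  have hm1 : 0 ≤ mom1 β a b τ κ := by unfold mom1; positivity
  unfold slopeDen
  positivity

theorem slope_mul_slopeDen {β a b τ κ : ℝ} (hden : slopeDen β a b τ κ ≠ 0) :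
    slope β a b τ κ * slopeDen β a b τ κ =
      (1 + 5 / 2 * deg β a b) * mom1 β a b τ κ + deg β a b * mom2 β a b τ κ := by
  rw [slope, div_mul_cancel₀ _ hden]

section Curve

variable {β : ℝ} {a b τ κ : ℝ → ℝ} {s g : ℝ}

theorem hasDerivAt_deg
    (ha : HasDerivAt a (a s * (1 - a s) * (τ s - g)) s)
    (hb : HasDerivAt b (b s * (1 - b s) * (κ s - g)) s) :
    HasDerivAt (fun t => deg β (a t) (b t))
      (mom1 β (a s) (b s) (τ s) (κ s) - g * mom0 β (a s) (b s)) s := by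
  unfold deg
  refine ((ha.const_mul β).add (hb.const_mul (1 - β))).congr_deriv ?_
  unfold mom1 mom0
  ring

theorem hasDerivAt_logistic {c : ℝ} (ha : HasDerivAt a (a s * (1 - a s) * c) s) :
    HasDerivAt (fun t => a t * (1 - a t)) (a s * (1 - a s) * ((1 - 2 * a s) * c)) s :=
  (ha.mul (ha.const_sub 1)).congr_deriv (by ring)

/-- The equation for `g'` is the derivative of `slope * slopeDen = numerator`. It is kept multiplied
by `slopeDen` because the estimates only need lower bounds for that denominator. The derivatives of
`τ` and `κ` are `-τ` and `-κ` since both are constants divided by `T`. -/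
theorem exists_hasDerivAt (hden : slopeDen β (a s) (b s) (τ s) (κ s) ≠ 0)
    (ha : HasDerivAt a (a s * (1 - a s) * (τ s - slope β (a s) (b s) (τ s) (κ s))) s)
    (hb : HasDerivAt b (b s * (1 - b s) * (κ s - slope β (a s) (b s) (τ s) (κ s))) s)
    (hτ : HasDerivAt τ (-τ s) s) (hκ : HasDerivAt κ (-κ s) s) :
    ∃ g' : ℝ,
      (g' * slopeDen β (a s) (b s) (τ s) (κ s) =
        (1 + 5 / 2 * deg β (a s) (b s)) *
            (sq1 β (a s) (b s) (τ s) (κ s) - mom1 β (a s) (b s) (τ s) (κ s)) +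
          5 / 2 * dDeg β (a s) (b s) (τ s) (κ s) ^ 2 +
          dDeg β (a s) (b s) (τ s) (κ s) * dHeat β (a s) (b s) (τ s) (κ s) +
          deg β (a s) (b s) * (sq2 β (a s) (b s) (τ s) (κ s) -
            dHeat β (a s) (b s) (τ s) (κ s) - mom2 β (a s) (b s) (τ s) (κ s)) -
          slope β (a s) (b s) (τ s) (κ s) * dDeg β (a s) (b s) (τ s) (κ s) *
            (1 + 2 * deg β (a s) (b s))) ∧
      HasDerivAt (fun t => dDeg β (a t) (b t) (τ t) (κ t))
        (sq1 β (a s) (b s) (τ s) (κ s) - mom1 β (a s) (b s) (τ s) (κ s) -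
          g' * mom0 β (a s) (b s)) s ∧
      HasDerivAt (fun t => dHeat β (a t) (b t) (τ t) (κ t))
        (sq2 β (a s) (b s) (τ s) (κ s) - dHeat β (a s) (b s) (τ s) (κ s) -
          mom2 β (a s) (b s) (τ s) (κ s) - g' * mom1 β (a s) (b s) (τ s) (κ s)) s := by
  obtain ⟨g, hg⟩ : ∃ g, g = slope β (a s) (b s) (τ s) (κ s) := ⟨_, rfl⟩
  obtain ⟨d, hd⟩ : ∃ d, d = mom1 β (a s) (b s) (τ s) (κ s) - g * mom0 β (a s) (b s) := ⟨_, rfl⟩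
  rw [← hg] at ha hb
  have hx := hasDerivAt_deg (β := β) ha hb
  have hA := hasDerivAt_logistic ha
  have hB := hasDerivAt_logistic hb
  have hm0 : HasDerivAt (fun t => mom0 β (a t) (b t))
      (β * (a s * (1 - a s) * ((1 - 2 * a s) * (τ s - g))) +
        (1 - β) * (b s * (1 - b s) * ((1 - 2 * b s) * (κ s - g)))) s := by
    unfold mom0
    simp only [mul_assoc β, mul_assoc (1 - β)]
    exact (hA.const_mul β).add (hB.const_mul (1 - β))
  have hm1 : HasDerivAt (fun t => mom1 β (a t) (b t) (τ t) (κ t))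
      (β * (a s * (1 - a s) * (τ s * ((1 - 2 * a s) * (τ s - g) - 1))) +
        (1 - β) * (b s * (1 - b s) * (κ s * ((1 - 2 * b s) * (κ s - g) - 1)))) s := by
    unfold mom1
    simp only [mul_assoc β, mul_assoc (1 - β)]
    refine (((hA.mul hτ).const_mul β).add ((hB.mul hκ).const_mul (1 - β))).congr_deriv ?_
    ring
  have hm2 : HasDerivAt (fun t => mom2 β (a t) (b t) (τ t) (κ t))
      (β * (a s * (1 - a s) * (τ s ^ 2 * ((1 - 2 * a s) * (τ s - g) - 2))) +
        (1 - β) * (b s * (1 - b s) * (κ s ^ 2 * ((1 - 2 * b s) * (κ s - g) - 2)))) s := by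
    unfold mom2
    simp only [mul_assoc β, mul_assoc (1 - β)]
    refine (((hA.mul (hτ.pow 2)).const_mul β).add
      ((hB.mul (hκ.pow 2)).const_mul (1 - β))).congr_deriv ?_
    simp only [Pi.pow_apply]
    ring
  set m0' := β * (a s * (1 - a s) * ((1 - 2 * a s) * (τ s - g))) +
    (1 - β) * (b s * (1 - b s) * ((1 - 2 * b s) * (κ s - g))) with hm0'
  set m1' := β * (a s * (1 - a s) * (τ s * ((1 - 2 * a s) * (τ s - g) - 1))) +
    (1 - β) * (b s * (1 - b s) * (κ s * ((1 - 2 * b s) * (κ s - g) - 1))) with hm1'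
  set m2' := β * (a s * (1 - a s) * (τ s ^ 2 * ((1 - 2 * a s) * (τ s - g) - 2))) +
    (1 - β) * (b s * (1 - b s) * (κ s ^ 2 * ((1 - 2 * b s) * (κ s - g) - 2))) with hm2'
  rw [← hd] at hx
  have hnum : HasDerivAt (fun t => (1 + 5 / 2 * deg β (a t) (b t)) * mom1 β (a t) (b t) (τ t) (κ t)
        + deg β (a t) (b t) * mom2 β (a t) (b t) (τ t) (κ t))
      (5 / 2 * d * mom1 β (a s) (b s) (τ s) (κ s) + (1 + 5 / 2 * deg β (a s) (b s)) * m1' +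
        (d * mom2 β (a s) (b s) (τ s) (κ s) + deg β (a s) (b s) * m2')) s :=
    (((hx.const_mul (5 / 2)).const_add 1).mul hm1).add (hx.mul hm2)
  have hdn : HasDerivAt (fun t => slopeDen β (a t) (b t) (τ t) (κ t))
      (5 / 2 * d * mom0 β (a s) (b s) + (1 + 5 / 2 * deg β (a s) (b s)) * m0' +
        (d * mom1 β (a s) (b s) (τ s) (κ s) + deg β (a s) (b s) * m1') +
        (d * (1 + deg β (a s) (b s)) + deg β (a s) (b s) * d)) s :=
    ((((hx.const_mul (5 / 2)).const_add 1).mul hm0).add (hx.mul hm1)).add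
      (hx.mul (hx.const_add 1))
  have hslope := hnum.div hdn hden
  obtain ⟨g', hg'⟩ : ∃ g', g' = (5 / 2 * d * mom1 β (a s) (b s) (τ s) (κ s) +
      (1 + 5 / 2 * deg β (a s) (b s)) * m1' +
      (d * mom2 β (a s) (b s) (τ s) (κ s) + deg β (a s) (b s) * m2') -
      g * (5 / 2 * d * mom0 β (a s) (b s) + (1 + 5 / 2 * deg β (a s) (b s)) * m0' +
        (d * mom1 β (a s) (b s) (τ s) (κ s) + deg β (a s) (b s) * m1') +
        (d * (1 + deg β (a s) (b s)) + deg β (a s) (b s) * d))) /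
      slopeDen β (a s) (b s) (τ s) (κ s) := ⟨_, rfl⟩
  have hg's : HasDerivAt (fun t => slope β (a t) (b t) (τ t) (κ t)) g' s := by
    refine hslope.congr_deriv ?_
    rw [← slope_mul_slopeDen hden, ← hg, hg']
    field_simp
  -- Such differences complete the squares: `τ - g` from the weights of the moments meets `τ - g`
  -- from the derivative of the weight.
  have hsq1 : m1' - g * m0' = sq1 β (a s) (b s) (τ s) (κ s) -
      mom1 β (a s) (b s) (τ s) (κ s) := by
    rw [hm1', hm0', sq1, ← hg, mom1]
    ring
  have hF : dHeat β (a s) (b s) (τ s) (κ s) =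
      mom2 β (a s) (b s) (τ s) (κ s) - g * mom1 β (a s) (b s) (τ s) (κ s) := by
    rw [dHeat, ← hg]
  have hD : dDeg β (a s) (b s) (τ s) (κ s) = d := by
    rw [dDeg, ← hg, hd]
  have hsq2 : m2' - g * m1' = sq2 β (a s) (b s) (τ s) (κ s) -
      dHeat β (a s) (b s) (τ s) (κ s) - mom2 β (a s) (b s) (τ s) (κ s) := by
    rw [hm1', hm2', sq2, hF, ← hg, mom1, mom2]
    ring
  refine ⟨g', ?_, ?_, ?_⟩
  · rw [← hg, hg', div_mul_cancel₀ _ hden, ← hsq1, ← hsq2, hF, hD]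
    linear_combination (5 / 2 * d) * (-hd)
  · refine (hm1.sub (hg's.mul hm0)).congr_deriv ?_
    rw [← hsq1, hg]
    ring
  · refine (hm2.sub (hg's.mul hm1)).congr_deriv ?_
    rw [← hsq2, hg]
    ring

/-- The case `c = 5/2` is `dLogP` and `c = 3/2` is `dLogRho`. -/
theorem hasDerivAt_dLog {c d' F' : ℝ} (hdeg : 1 + deg β (a s) (b s) ≠ 0)
    (hx : HasDerivAt (fun t => deg β (a t) (b t)) (dDeg β (a s) (b s) (τ s) (κ s)) s)
    (hd : HasDerivAt (fun t => dDeg β (a t) (b t) (τ t) (κ t)) d' s)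
    (hF : HasDerivAt (fun t => dHeat β (a t) (b t) (τ t) (κ t)) F' s) :
    HasDerivAt (fun t => c + (c * dDeg β (a t) (b t) (τ t) (κ t) +
        dHeat β (a t) (b t) (τ t) (κ t)) / (1 + deg β (a t) (b t)))
      ((c * d' + F') / (1 + deg β (a s) (b s)) -
        (c * dDeg β (a s) (b s) (τ s) (κ s) + dHeat β (a s) (b s) (τ s) (κ s)) *
          dDeg β (a s) (b s) (τ s) (κ s) / (1 + deg β (a s) (b s)) ^ 2) s := by
  refine ((((hd.const_mul c).add hF).div (hx.const_add 1) hdeg).const_add c).congr_deriv ?_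
  simp only [Pi.add_apply]
  field_simp

end Curve

section Smooth

variable {E : Type*} [NormedAddCommGroup E] [NormedSpace ℝ E] {n : WithTop ℕ∞} {β : ℝ}
  {a b τ κ : E → ℝ} {w : E}

theorem contDiffAt_slope (ha : ContDiffAt ℝ n a w) (hb : ContDiffAt ℝ n b w)
    (hτ : ContDiffAt ℝ n τ w) (hκ : ContDiffAt ℝ n κ w)
    (hden : slopeDen β (a w) (b w) (τ w) (κ w) ≠ 0) :
    ContDiffAt ℝ n (fun z => slope β (a z) (b z) (τ z) (κ z)) w := by
  unfold slope
  refine ContDiffAt.div ?_ ?_ hden <;> (try unfold slopeDen) <;>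
    (try unfold mom2) <;> (try unfold mom0) <;> unfold deg mom1 <;> fun_prop

theorem contDiffAt_dDeg (ha : ContDiffAt ℝ n a w) (hb : ContDiffAt ℝ n b w)
    (hτ : ContDiffAt ℝ n τ w) (hκ : ContDiffAt ℝ n κ w)
    (hden : slopeDen β (a w) (b w) (τ w) (κ w) ≠ 0) :
    ContDiffAt ℝ n (fun z => dDeg β (a z) (b z) (τ z) (κ z)) w := by
  have := contDiffAt_slope ha hb hτ hκ hden
  unfold dDeg mom0 mom1
  fun_prop

theorem contDiffAt_dHeat (ha : ContDiffAt ℝ n a w) (hb : ContDiffAt ℝ n b w)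
    (hτ : ContDiffAt ℝ n τ w) (hκ : ContDiffAt ℝ n κ w)
    (hden : slopeDen β (a w) (b w) (τ w) (κ w) ≠ 0) :
    ContDiffAt ℝ n (fun z => dHeat β (a z) (b z) (τ z) (κ z)) w := by
  have := contDiffAt_slope ha hb hτ hκ hden
  unfold dHeat mom1 mom2
  fun_prop

theorem contDiffAt_deg (ha : ContDiffAt ℝ n a w) (hb : ContDiffAt ℝ n b w) :
    ContDiffAt ℝ n (fun z => deg β (a z) (b z)) w := by
  unfold deg
  fun_prop

theorem contDiffAt_dLogP (ha : ContDiffAt ℝ n a w) (hb : ContDiffAt ℝ n b w)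
    (hτ : ContDiffAt ℝ n τ w) (hκ : ContDiffAt ℝ n κ w)
    (hden : slopeDen β (a w) (b w) (τ w) (κ w) ≠ 0) (hdeg : 1 + deg β (a w) (b w) ≠ 0) :
    ContDiffAt ℝ n (fun z => dLogP β (a z) (b z) (τ z) (κ z)) w :=
  contDiffAt_const.add (((contDiffAt_const.mul (contDiffAt_dDeg ha hb hτ hκ hden)).add
    (contDiffAt_dHeat ha hb hτ hκ hden)).div (contDiffAt_const.add (contDiffAt_deg ha hb)) hdeg)

theorem contDiffAt_dLogRho (ha : ContDiffAt ℝ n a w) (hb : ContDiffAt ℝ n b w)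
    (hτ : ContDiffAt ℝ n τ w) (hκ : ContDiffAt ℝ n κ w)
    (hden : slopeDen β (a w) (b w) (τ w) (κ w) ≠ 0) (hdeg : 1 + deg β (a w) (b w) ≠ 0) :
    ContDiffAt ℝ n (fun z => dLogRho β (a z) (b z) (τ z) (κ z)) w :=
  contDiffAt_const.add (((contDiffAt_const.mul (contDiffAt_dDeg ha hb hτ hκ hden)).add
    (contDiffAt_dHeat ha hb hτ hκ hden)).div (contDiffAt_const.add (contDiffAt_deg ha hb)) hdeg)

end Smooth

end Isentrope

/-! ### Increase of the sound speed in the weakly ionized regime -/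

theorem abs_quotient_derivative_sub_le {c d F d' F' x f η : ℝ} (hη : 0 < η)
    (hη1 : η ≤ 1 / 1000000) (hc : 0 ≤ c) (hc' : c ≤ 5 / 2) (hx : 0 ≤ x) (hxη : x ≤ η)
    (hf0 : 0 ≤ f) (hf : f ≤ 15) (hd : |d| ≤ 2 * η) (hF : |F| ≤ 4 * η)
    (hd' : |d'| ≤ 540 * η) (hF' : |F' - f| ≤ 8600 * η) :
    |(c * d' + F') / (1 + x) - (c * d + F) * d / (1 + x) ^ 2 - f| ≤ 10000 * η := by
  have hx1 : 0 < 1 + x := by linarith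
  have hcabs : |c| ≤ 5 / 2 := by rwa [abs_of_nonneg hc]
  -- The constant is `5/2 · 540 + 8600 + 15`; the last summand is the effect of the divisor `1 + x`
  -- on `f`.
  have h1 : |(c * d' + F' - f - f * x) / (1 + x)| ≤ 9965 * η := by
    rw [abs_div, abs_of_pos hx1]
    refine (div_le_self (abs_nonneg _) (by linarith)).trans ?_
    have e1 : |c * d'| ≤ 5 / 2 * (540 * η) := abs_mul_le_mul hcabs hd'
    have e2 : f * x ≤ 15 * η := by gcongr
    have e3 : 0 ≤ f * x := by positivity
    rw [abs_le] at e1 hF' ⊢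
    constructor <;> linarith
  have h2 : |(c * d + F) * d / (1 + x) ^ 2| ≤ 9 * η * (2 * η) := by
    rw [abs_div, abs_of_pos (by positivity : 0 < (1 + x) ^ 2)]
    refine (div_le_self (abs_nonneg _) (one_le_pow₀ (by linarith))).trans ?_
    refine abs_mul_le_mul ?_ hd
    have e1 : |c * d| ≤ 5 / 2 * (2 * η) := abs_mul_le_mul hcabs hd
    rw [abs_le] at e1 hF ⊢
    constructor <;> linarith
  have h3 : (c * d' + F') / (1 + x) - (c * d + F) * d / (1 + x) ^ 2 - f =
      (c * d' + F' - f - f * x) / (1 + x) - (c * d + F) * d / (1 + x) ^ 2 := by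
    field_simp
    ring
  have h4 : η * η ≤ η * (1 / 1000000) := by gcongr
  rw [h3]
  rw [abs_le] at h1 h2 ⊢
  constructor <;> linarith

theorem abs_const_add_quotient_sub_le {c d F x η : ℝ} (hc : 0 ≤ c) (hc' : c ≤ 5 / 2) (hx : 0 ≤ x)
    (hd : |d| ≤ 2 * η) (hF : |F| ≤ 4 * η) : |c + (c * d + F) / (1 + x) - c| ≤ 20 * η := by
  have hx1 : 0 < 1 + x := by linarith
  have hη : 0 ≤ η := by linarith [abs_nonneg d]
  rw [add_sub_cancel_left, abs_div, abs_of_pos hx1]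
  refine (div_le_self (abs_nonneg _) (by linarith)).trans ?_
  have e1 : |c * d| ≤ 5 / 2 * (2 * η) := abs_mul_le_mul (by rwa [abs_of_nonneg hc]) hd
  rw [abs_le] at e1 hF ⊢
  constructor <;> linarith

namespace WeakIonization

open Isentrope

theorem exists_hasDerivAt_pos {η β : ℝ} {a b τ κ : ℝ → ℝ} {s : ℝ} (hβ : 0 < β) (hβ1 : β ≤ 1)
    (h : WeakIonization η (β * a s) ((1 - β) * b s) (a s) (b s) (τ s) (κ s))
    (h60 : β * a s * τ s ^ 3 ≤ 60 - 300000 * η)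
    (ha : HasDerivAt a (a s * (1 - a s) * (τ s - slope β (a s) (b s) (τ s) (κ s))) s)
    (hb : HasDerivAt b (b s * (1 - b s) * (κ s - slope β (a s) (b s) (τ s) (κ s))) s)
    (hτ : HasDerivAt τ (-τ s) s) (hκ : HasDerivAt κ (-κ s) s) :
    0 < dLogP β (a s) (b s) (τ s) (κ s) ∧ 0 < dLogRho β (a s) (b s) (τ s) (κ s) ∧ ∃ r' q' : ℝ,
      HasDerivAt (fun t => dLogP β (a t) (b t) (τ t) (κ t)) r' s ∧
      HasDerivAt (fun t => dLogRho β (a t) (b t) (τ t) (κ t)) q' s ∧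
      0 < dLogP β (a s) (b s) (τ s) (κ s) + dLogRho β (a s) (b s) (τ s) (κ s) +
        r' / dLogP β (a s) (b s) (τ s) (κ s) - q' / dLogRho β (a s) (b s) (τ s) (κ s) := by
  have hη := h.η_pos
  have hη' := h.η_le
  have hτ0 := h.τ_pos
  have ha1 : a s < 1 := by linarith [h.a_le]
  have hb1 : b s < 1 := by linarith [h.b_le]
  have hκ0 : 0 < κ s := h.τ_pos.trans_le h.τ_le
  have hden : slopeDen β (a s) (b s) (τ s) (κ s) ≠ 0 :=
    (slopeDen_pos hβ hβ1 h.a_pos ha1 h.b_pos hb1 h.τ_pos hκ0).ne'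
  have hx0 : 0 < deg β (a s) (b s) := deg_pos hβ hβ1 h.a_pos h.b_pos
  have hxη : deg β (a s) (b s) ≤ η := h.zeroth
  have hx1 : 1 + deg β (a s) (b s) ≠ 0 := by positivity
  obtain ⟨g', hg', hd, hF⟩ := exists_hasDerivAt hden ha hb hτ hκ
  obtain ⟨hdle, hFle, hd'le, hF'le, hY⟩ := h.bounds (dx := dDeg β (a s) (b s) (τ s) (κ s))
    (F := dHeat β (a s) (b s) (τ s) (κ s)) rfl rfl rfl rfl rfl rfl rfl rfl
    (slope_mul_slopeDen hden) (by unfold dDeg mom1 mom0; ring) (by unfold dHeat mom1 mom2; ring)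
    rfl rfl hg'
  have hdeg := hasDerivAt_deg (β := β) ha hb
  have hP := hasDerivAt_dLog (c := 5 / 2) hx1 hdeg hd hF
  have hR := hasDerivAt_dLog (c := 3 / 2) hx1 hdeg hd hF
  have hA0 := h.A_nonneg
  set f := β * a s * (1 - a s) * τ s * (τ s - slope β (a s) (b s) (τ s) (κ s)) ^ 2 with hf
  have hf0 : 0 ≤ f := by positivity
  -- Up to errors, `f ≤ (P τ³) (1/2)² ≤ 60 / 4`. The factor `(1/2 + 10 η)²` costs about `600 η`,
  -- while the margin `300000 η` in `h60` yields `75000 η`.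
  have hf1 : f ≤ 15 - 50000 * η := by
    have e1 : (τ s - slope β (a s) (b s) (τ s) (κ s)) ^ 2 ≤ ((1 / 2 + 10 * η) * τ s) ^ 2 := by
      rw [← sq_abs]; gcongr
    have e2 : β * a s * (1 - a s) ≤ β * a s := h.A_le
    have e3 : 0 < β * a s := h.P_pos
    calc f ≤ β * a s * τ s * ((1 / 2 + 10 * η) * τ s) ^ 2 := by rw [hf]; gcongr
      _ = β * a s * τ s ^ 3 * (1 / 2 + 10 * η) ^ 2 := by ring
      _ ≤ (60 - 300000 * η) * (1 / 2 + 10 * η) ^ 2 := by gcongr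
      _ ≤ 15 - 50000 * η := by
        have e4 : 0 < η * η := by positivity
        have e5 : η * η ≤ η * (1 / 1000000) := by gcongr
        have e6 : 0 < η * η * η := by positivity
        nlinarith
  have hf15 : f ≤ 15 := by linarith
  have hr := abs_const_add_quotient_sub_le (c := 5 / 2) (by norm_num) le_rfl hx0.le hdle hFle
  have hq := abs_const_add_quotient_sub_le (c := 3 / 2) (by norm_num) (by norm_num) hx0.le hdle hFle
  refine ⟨?_, ?_, _, _, hP, hR, logDeriv_pos hf0 hη hη' hf1 hr hq
    (abs_quotient_derivative_sub_le hη hη' (by norm_num) le_rfl hx0.le hxη hf0 hf15 hdle hFle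
      hd'le hF'le)
    (abs_quotient_derivative_sub_le hη hη' (by norm_num) (by norm_num) hx0.le hxη hf0 hf15 hdle
      hFle hd'le hF'le)⟩
  · have := (abs_le.1 hr).1
    unfold dLogP
    linarith
  · have := (abs_le.1 hq).1
    unfold dLogRho
    linarith

end WeakIonization

/-! ### Thermodynamic functions along an isentrope -/

namespace IonizedMixture

open Isentrope

variable (G : IonizedMixture)

theorem M_pos : 0 < G.M := by
  have h1 := G.β_pos
  have h2 := sub_nonneg.2 G.β_le_one
  have h3 := G.MA_pos
  have h4 := G.MB_pos
  unfold M
  positivity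

theorem alphaB_pos {T a : ℝ} (ha : 0 < a) (ha' : a < 1) : 0 < G.alphaB T a := by
  have h1 := G.μA_pos
  have h2 := G.μB_pos
  have h3 : 0 < 1 - a := sub_pos.2 ha'
  unfold alphaB
  positivity

theorem alphaB_lt_one {T a : ℝ} (ha : 0 < a) (ha' : a < 1) : G.alphaB T a < 1 := by
  have h1 := G.μA_pos
  have h2 := G.μB_pos
  have h3 : 0 < 1 - a := sub_pos.2 ha'
  unfold alphaB
  rw [div_lt_one (by positivity)]
  have : 0 < G.μB * (1 - a) := by positivity
  linarith

theorem alpha_pos {T a : ℝ} (ha : 0 < a) (ha' : a < 1) : 0 < G.alpha T a :=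
  deg_pos G.β_pos G.β_le_one ha (G.alphaB_pos ha ha')

theorem p_pos {T a : ℝ} (hT : 0 < T) (ha : 0 < a) (ha' : a < 1) : 0 < G.p T a := by
  have h1 := G.μA_pos
  have h2 := G.alpha_pos (T := T) ha ha'
  have h3 : 0 < 1 - a := sub_pos.2 ha'
  unfold p
  positivity

theorem v_pos {T a : ℝ} (hT : 0 < T) (ha : 0 < a) (ha' : a < 1) : 0 < G.v T a := by
  have h1 := G.R_pos
  have h2 := G.alpha_pos (T := T) ha ha'
  have h3 := G.p_pos hT ha ha'
  have h4 := G.M_pos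
  unfold v
  positivity

/-- The slope of the isentrope through `(T, a)`. -/
def isoSlope (T a : ℝ) : ℝ := slope G.β a (G.alphaB T a) (G.TA / T) (G.TB / T)

/-- The derivative of `log p` with respect to `log T` along the isentrope. -/
def isoP (T a : ℝ) : ℝ := dLogP G.β a (G.alphaB T a) (G.TA / T) (G.TB / T)

/-- The derivative of `-log v` with respect to `log T` along the isentrope. -/
def isoRho (T a : ℝ) : ℝ := dLogRho G.β a (G.alphaB T a) (G.TA / T) (G.TB / T)

theorem isoDen_ne_zero {T a : ℝ} (hT : 0 < T) (ha : 0 < a) (ha' : a < 1) :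
    slopeDen G.β a (G.alphaB T a) (G.TA / T) (G.TB / T) ≠ 0 :=
  (slopeDen_pos G.β_pos G.β_le_one ha ha' (G.alphaB_pos ha ha') (G.alphaB_lt_one ha ha')
    (div_pos G.TA_pos hT) (div_pos (G.TA_pos.trans G.TA_lt_TB) hT)).ne'

section Curve

variable {G} {T a : ℝ → ℝ} {s g : ℝ}

/-- The hypothesis `HasDerivAt T (T s) s` says that the parameter agrees with `log T` to first order
at `s` only. The curve need not be an isentrope, merely tangent to one, so straight lines through a
state are admissible. -/
theorem hasDerivAt_const_div (hT : HasDerivAt T (T s) s) (hT0 : T s ≠ 0) (c : ℝ) :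
    HasDerivAt (fun t => c / T t) (-(c / T s)) s := by
  refine ((hasDerivAt_const s c).div hT hT0).congr_deriv ?_
  field_simp
  ring

theorem hasDerivAt_exp_div (hT : HasDerivAt T (T s) s) (hT0 : T s ≠ 0) (c : ℝ) :
    HasDerivAt (fun t => Real.exp (-c / T t)) (Real.exp (-c / T s) * (c / T s)) s := by
  refine (hasDerivAt_const_div hT hT0 (-c)).exp.congr_deriv ?_
  ring

/-- By the compatibility of the Saha laws, the logit of `alphaB` is that of `a` minus `(T_B - T_A) /
T` plus a constant. Its derivative exceeds that of the logit of `a` by `κ - τ`, so the same `g`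
serves both gases. -/
theorem hasDerivAt_alphaB (hT : HasDerivAt T (T s) s) (hT0 : 0 < T s)
    (ha0 : 0 < a s) (ha1 : a s < 1)
    (ha : HasDerivAt a (a s * (1 - a s) * (G.TA / T s - g)) s) :
    HasDerivAt (fun t => G.alphaB (T t) (a t))
      (G.alphaB (T s) (a s) * (1 - G.alphaB (T s) (a s)) * (G.TB / T s - g)) s := by
  have hE := hasDerivAt_exp_div hT hT0.ne' (G.TB - G.TA)
  have h1 := G.μA_pos
  have h2 := G.μB_pos
  have h3 : 0 < 1 - a s := sub_pos.2 ha1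
  have hn := (ha.const_mul G.μA).mul hE
  have hm := (ha.const_sub 1).const_mul G.μB
  have hden : G.μA * a s * Real.exp (-(G.TB - G.TA) / T s) + G.μB * (1 - a s) ≠ 0 := by positivity
  refine (hn.div (hn.add hm) hden).congr_deriv ?_
  simp only [Pi.mul_apply, Pi.add_apply]
  unfold alphaB
  generalize Real.exp (-(G.TB - G.TA) / T s) = E at *
  obtain ⟨D, hD⟩ : ∃ D, D = G.μA * a s * E + G.μB * (1 - a s) := ⟨_, rfl⟩
  have h4 : 1 - G.μA * a s * E / D = G.μB * (1 - a s) / D := by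
    rw [← hD] at hden
    field_simp
    linarith
  rw [← hD] at hden ⊢
  rw [h4]
  have hT0' := hT0.ne'
  field_simp
  rw [hD]
  ring

theorem hasDerivAt_alpha (hT : HasDerivAt T (T s) s) (hT0 : 0 < T s)
    (ha0 : 0 < a s) (ha1 : a s < 1)
    (ha : HasDerivAt a (a s * (1 - a s) * (G.TA / T s - G.isoSlope (T s) (a s))) s) :
    HasDerivAt (fun t => G.alpha (T t) (a t))
      (dDeg G.β (a s) (G.alphaB (T s) (a s)) (G.TA / T s) (G.TB / T s)) s :=
  hasDerivAt_deg (τ := fun t => G.TA / T t) (κ := fun t => G.TB / T t)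
    (b := fun t => G.alphaB (T t) (a t)) ha (hasDerivAt_alphaB hT hT0 ha0 ha1 ha)

/-- This identity motivates the definition of `slope`: Saha's law gives `d log p = 5/2 + g - dα / (α
(1 + α))`, the isentropic relation `dh = v dp` gives `dLogP`, and equating the two determines `g`.
-/
theorem isentropic_identity {T a : ℝ} (hT0 : 0 < T) (ha0 : 0 < a) (ha1 : a < 1) :
    (1 + 5 / 2 * G.alpha T a) * dDeg G.β a (G.alphaB T a) (G.TA / T) (G.TB / T) +
      G.alpha T a * dHeat G.β a (G.alphaB T a) (G.TA / T) (G.TB / T) =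
      G.isoSlope T a * (G.alpha T a * (1 + G.alpha T a)) := by
  have h := slope_mul_slopeDen (G.isoDen_ne_zero hT0 ha0 ha1)
  change _ = slope _ _ _ _ _ * (deg _ _ _ * (1 + deg _ _ _))
  unfold dDeg dHeat
  change (1 + 5 / 2 * deg _ _ _) * _ + deg _ _ _ * _ = _
  unfold slopeDen at h
  linear_combination (-1 : ℝ) * h

theorem hasDerivAt_p (hT : HasDerivAt T (T s) s) (hT0 : 0 < T s)
    (ha0 : 0 < a s) (ha1 : a s < 1)
    (ha : HasDerivAt a (a s * (1 - a s) * (G.TA / T s - G.isoSlope (T s) (a s))) s) :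
    HasDerivAt (fun t => G.p (T t) (a t))
      (G.p (T s) (a s) * G.isoP (T s) (a s)) s := by
  have hE := hasDerivAt_exp_div hT hT0.ne' G.TA
  have hx := hasDerivAt_alpha hT hT0 ha0 ha1 ha
  have hx0 := G.alpha_pos (T := T s) ha0 ha1
  have hμ := G.μA_pos
  have h3 : 0 < 1 - a s := sub_pos.2 ha1
  have hden : G.μA * a s * G.alpha (T s) (a s) ≠ 0 := by positivity
  have hpow : HasDerivAt (fun t => T t ^ (5 / 2 : ℝ)) (5 / 2 * T s ^ (5 / 2 : ℝ)) s := by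
    refine (hT.rpow_const (p := (5 / 2 : ℝ)) (Or.inl hT0.ne')).congr_deriv ?_
    rw [Real.rpow_sub_one hT0.ne']
    field_simp
  have hmain := ((((ha.const_sub 1).mul (hx.const_add 1)).div
    ((ha.const_mul G.μA).mul hx) hden).mul hpow).mul hE
  refine hmain.congr_deriv ?_
  have hid := isentropic_identity (G := G) hT0 ha0 ha1
  have hP : G.isoP (T s) (a s) = 5 / 2 + G.isoSlope (T s) (a s) -
      dDeg G.β (a s) (G.alphaB (T s) (a s)) (G.TA / T s) (G.TB / T s) /
        (G.alpha (T s) (a s) * (1 + G.alpha (T s) (a s))) := by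
    have e : G.isoSlope (T s) (a s) = ((1 + 5 / 2 * G.alpha (T s) (a s)) *
        dDeg G.β (a s) (G.alphaB (T s) (a s)) (G.TA / T s) (G.TB / T s) +
      G.alpha (T s) (a s) * dHeat G.β (a s) (G.alphaB (T s) (a s)) (G.TA / T s) (G.TB / T s)) /
      (G.alpha (T s) (a s) * (1 + G.alpha (T s) (a s))) := by
      rw [hid]; field_simp
    rw [e]
    change 5 / 2 + _ / (1 + G.alpha (T s) (a s)) = _
    field_simp
    ring
  rw [hP]
  simp only [Pi.mul_apply, Pi.div_apply]
  unfold p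
  generalize Real.exp (-G.TA / T s) = E
  generalize T s ^ (5 / 2 : ℝ) = W
  generalize dDeg G.β (a s) (G.alphaB (T s) (a s)) (G.TA / T s) (G.TB / T s) = d
  generalize G.isoSlope (T s) (a s) = g at *
  generalize G.alpha (T s) (a s) = x at *
  field_simp
  ring

theorem hasDerivAt_v (hT : HasDerivAt T (T s) s) (hT0 : 0 < T s)
    (ha0 : 0 < a s) (ha1 : a s < 1)
    (ha : HasDerivAt a (a s * (1 - a s) * (G.TA / T s - G.isoSlope (T s) (a s))) s) :
    HasDerivAt (fun t => G.v (T t) (a t))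
      (-(G.v (T s) (a s) * G.isoRho (T s) (a s))) s := by
  have hx := hasDerivAt_alpha hT hT0 ha0 ha1 ha
  have hp := hasDerivAt_p hT hT0 ha0 ha1 ha
  have hp0 := G.p_pos hT0 ha0 ha1
  have hx0 := G.alpha_pos (T := T s) ha0 ha1
  refine (((hT.const_mul (G.R / G.M)).mul (hx.const_add 1)).div hp hp0.ne').congr_deriv ?_
  have e : G.isoRho (T s) (a s) = G.isoP (T s) (a s) - 1 -
      dDeg G.β (a s) (G.alphaB (T s) (a s)) (G.TA / T s) (G.TB / T s) /
        (1 + G.alpha (T s) (a s)) := by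
    change 3 / 2 + _ / (1 + G.alpha (T s) (a s)) =
      5 / 2 + _ / (1 + G.alpha (T s) (a s)) - 1 - _
    field_simp
    ring
  rw [e]
  simp only [Pi.mul_apply]
  unfold v
  generalize G.isoP (T s) (a s) = r
  generalize dDeg G.β (a s) (G.alphaB (T s) (a s)) (G.TA / T s) (G.TB / T s) = d
  have hM := G.M_pos
  field_simp
  ring

theorem p_mul_v {T a : ℝ} (hT : 0 < T) (ha : 0 < a) (ha' : a < 1) :
    G.p T a * G.v T a = G.R / G.M * T * (1 + G.alpha T a) := by
  have := (G.p_pos hT ha ha').ne'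
  unfold v
  field_simp

/-- This is `de = -p dv`, obtained from `dh = v dp` (the step `hh`) by subtracting `d(p v)`. -/
theorem hasDerivAt_e (hT : HasDerivAt T (T s) s) (hT0 : 0 < T s)
    (ha0 : 0 < a s) (ha1 : a s < 1)
    (ha : HasDerivAt a (a s * (1 - a s) * (G.TA / T s - G.isoSlope (T s) (a s))) s) :
    HasDerivAt (fun t => G.e (T t) (a t))
      (G.p (T s) (a s) * G.v (T s) (a s) * G.isoRho (T s) (a s)) s := by
  have hx := hasDerivAt_alpha hT hT0 ha0 ha1 ha
  have hb := hasDerivAt_alphaB hT hT0 ha0 ha1 ha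
  have hp := hasDerivAt_p hT hT0 ha0 ha1 ha
  have hv := hasDerivAt_v hT hT0 ha0 ha1 ha
  have hx0 := G.alpha_pos (T := T s) ha0 ha1
  have hM := G.M_pos
  have hh : HasDerivAt (fun t => G.enthalpy (T t) (a t))
      (G.p (T s) (a s) * G.v (T s) (a s) * G.isoP (T s) (a s)) s := by
    have := (((hT.const_mul (5 * G.R)).div_const (2 * G.M)).mul (hx.const_add 1)).add
      (((ha.const_mul (G.β * G.TA)).add (hb.const_mul ((1 - G.β) * G.TB))).const_mul (G.R / G.M))
    refine this.congr_deriv ?_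
    rw [p_mul_v hT0 ha0 ha1]
    have e : G.isoP (T s) (a s) = 5 / 2 + (5 / 2 * dDeg G.β (a s) (G.alphaB (T s) (a s))
      (G.TA / T s) (G.TB / T s) + dHeat G.β (a s) (G.alphaB (T s) (a s)) (G.TA / T s)
        (G.TB / T s)) / (1 + G.alpha (T s) (a s)) := rfl
    have e2 : T s * dHeat G.β (a s) (G.alphaB (T s) (a s)) (G.TA / T s) (G.TB / T s) =
        G.β * G.TA * (a s * (1 - a s) * (G.TA / T s - G.isoSlope (T s) (a s))) +
        (1 - G.β) * G.TB * (G.alphaB (T s) (a s) * (1 - G.alphaB (T s) (a s)) *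
          (G.TB / T s - G.isoSlope (T s) (a s))) := by
      unfold dHeat mom2 mom1
      change T s * (_ - G.isoSlope (T s) (a s) * _) = _
      field_simp
      ring
    rw [← e2, e]
    field_simp
    ring
  refine (hh.sub (hp.mul hv)).congr_deriv ?_
  ring

end Curve

end IonizedMixture

/-! ### Characteristic fields and genuine nonlinearity -/

namespace IonizedMixture

open Isentrope

variable (G : IonizedMixture)

/-- The Lagrangian sound speed `√(-∂p/∂v)` along the isentrope. -/
def soundSpeed (T a : ℝ) : ℝ := Real.sqrt (G.p T a * G.isoP T a / (G.v T a * G.isoRho T a))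

/-- The characteristic vector field of the speed `ε * soundSpeed`, where `ε = ± 1`. -/
def charField (ε : ℝ) (w : ℝ × ℝ × ℝ) : ℝ × ℝ × ℝ :=
  (w.1, w.2.1 * (1 - w.2.1) * (G.TA / w.1 - G.isoSlope w.1 w.2.1),
    ε * G.soundSpeed w.1 w.2.1 * (G.v w.1 w.2.1 * G.isoRho w.1 w.2.1))

section Smooth

variable {G} {w : ℝ × ℝ × ℝ} {n : WithTop ℕ∞}

theorem contDiffAt_alphaB (hT : 0 < w.1) (ha : 0 < w.2.1) (ha' : w.2.1 < 1) :
    ContDiffAt ℝ n (fun z : ℝ × ℝ × ℝ => G.alphaB z.1 z.2.1) w := by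
  have h1 := G.μA_pos
  have h2 := G.μB_pos
  have h3 : 0 < 1 - w.2.1 := sub_pos.2 ha'
  have hden : G.μA * w.2.1 * Real.exp (-(G.TB - G.TA) / w.1) + G.μB * (1 - w.2.1) ≠ 0 := by
    positivity
  have hE : ContDiffAt ℝ n (fun z : ℝ × ℝ × ℝ => Real.exp (-(G.TB - G.TA) / z.1)) w :=
    (contDiffAt_const.div contDiffAt_fst hT.ne').exp
  unfold alphaB
  refine ContDiffAt.div ?_ ?_ hden <;> fun_prop

theorem contDiffAt_const_div (hT : 0 < w.1) (c : ℝ) :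
    ContDiffAt ℝ n (fun z : ℝ × ℝ × ℝ => c / z.1) w :=
  contDiffAt_const.div contDiffAt_fst hT.ne'

theorem contDiffAt_snd_fst : ContDiffAt ℝ n (fun z : ℝ × ℝ × ℝ => z.2.1) w := by fun_prop

theorem contDiffAt_alpha (hT : 0 < w.1) (ha : 0 < w.2.1) (ha' : w.2.1 < 1) :
    ContDiffAt ℝ n (fun z : ℝ × ℝ × ℝ => G.alpha z.1 z.2.1) w :=
  contDiffAt_deg contDiffAt_snd_fst (contDiffAt_alphaB hT ha ha')

theorem contDiffAt_p (hT : 0 < w.1) (ha : 0 < w.2.1) (ha' : w.2.1 < 1) :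
    ContDiffAt ℝ n (fun z : ℝ × ℝ × ℝ => G.p z.1 z.2.1) w := by
  have hx := contDiffAt_alpha (G := G) (n := n) hT ha ha'
  have h1 := G.μA_pos
  have h2 := G.alpha_pos (T := w.1) ha ha'
  have hden : G.μA * w.2.1 * G.alpha w.1 w.2.1 ≠ 0 := by positivity
  have hfrac : ContDiffAt ℝ n (fun z : ℝ × ℝ × ℝ =>
      (1 - z.2.1) * (1 + G.alpha z.1 z.2.1) / (G.μA * z.2.1 * G.alpha z.1 z.2.1)) w := by
    refine ContDiffAt.div ?_ ?_ hden <;> fun_prop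
  exact (hfrac.mul (contDiffAt_fst.rpow_const_of_ne hT.ne')).mul (contDiffAt_const_div hT _).exp

theorem contDiffAt_v (hT : 0 < w.1) (ha : 0 < w.2.1) (ha' : w.2.1 < 1) :
    ContDiffAt ℝ n (fun z : ℝ × ℝ × ℝ => G.v z.1 z.2.1) w :=
  ((contDiffAt_const.mul contDiffAt_fst).mul
    (contDiffAt_const.add (contDiffAt_alpha hT ha ha'))).div
    (contDiffAt_p hT ha ha') (G.p_pos hT ha ha').ne'

theorem contDiffAt_e (hT : 0 < w.1) (ha : 0 < w.2.1) (ha' : w.2.1 < 1) :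
    ContDiffAt ℝ n (fun z : ℝ × ℝ × ℝ => G.e z.1 z.2.1) w := by
  have hx := contDiffAt_alpha (G := G) (n := n) hT ha ha'
  have hb := contDiffAt_alphaB (G := G) (n := n) hT ha ha'
  have hp := contDiffAt_p (G := G) (n := n) hT ha ha'
  have hv := contDiffAt_v (G := G) (n := n) hT ha ha'
  unfold e enthalpy
  fun_prop

theorem contDiffAt_isoSlope (hT : 0 < w.1) (ha : 0 < w.2.1) (ha' : w.2.1 < 1) :
    ContDiffAt ℝ n (fun z : ℝ × ℝ × ℝ => G.isoSlope z.1 z.2.1) w :=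
  contDiffAt_slope contDiffAt_snd_fst (contDiffAt_alphaB hT ha ha') (contDiffAt_const_div hT _)
    (contDiffAt_const_div hT _) (G.isoDen_ne_zero hT ha ha')

theorem contDiffAt_isoP (hT : 0 < w.1) (ha : 0 < w.2.1) (ha' : w.2.1 < 1) :
    ContDiffAt ℝ n (fun z : ℝ × ℝ × ℝ => G.isoP z.1 z.2.1) w :=
  contDiffAt_dLogP contDiffAt_snd_fst (contDiffAt_alphaB hT ha ha') (contDiffAt_const_div hT _)
    (contDiffAt_const_div hT _) (G.isoDen_ne_zero hT ha ha')
    (add_pos one_pos (G.alpha_pos ha ha')).ne'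

theorem contDiffAt_isoRho (hT : 0 < w.1) (ha : 0 < w.2.1) (ha' : w.2.1 < 1) :
    ContDiffAt ℝ n (fun z : ℝ × ℝ × ℝ => G.isoRho z.1 z.2.1) w :=
  contDiffAt_dLogRho contDiffAt_snd_fst (contDiffAt_alphaB hT ha ha') (contDiffAt_const_div hT _)
    (contDiffAt_const_div hT _) (G.isoDen_ne_zero hT ha ha')
    (add_pos one_pos (G.alpha_pos ha ha')).ne'

theorem contDiffAt_soundSpeed (hT : 0 < w.1) (ha : 0 < w.2.1) (ha' : w.2.1 < 1)
    (hr : 0 < G.isoP w.1 w.2.1) (hq : 0 < G.isoRho w.1 w.2.1) :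
    ContDiffAt ℝ n (fun z : ℝ × ℝ × ℝ => G.soundSpeed z.1 z.2.1) w := by
  have hp0 := G.p_pos hT ha ha'
  have hv0 := G.v_pos hT ha ha'
  refine ContDiffAt.sqrt (((contDiffAt_p hT ha ha').mul (contDiffAt_isoP hT ha ha')).div
    ((contDiffAt_v hT ha ha').mul (contDiffAt_isoRho hT ha ha')) ?_) ?_ <;> positivity

theorem contDiffAt_charField (ε : ℝ) (hT : 0 < w.1) (ha : 0 < w.2.1) (ha' : w.2.1 < 1)
    (hr : 0 < G.isoP w.1 w.2.1) (hq : 0 < G.isoRho w.1 w.2.1) :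
    ContDiffAt ℝ n (G.charField ε) w := by
  have hs := contDiffAt_isoSlope (G := G) (n := n) hT ha ha'
  have hc := contDiffAt_soundSpeed (G := G) (n := n) hT ha ha' hr hq
  have hv := contDiffAt_v (G := G) (n := n) hT ha ha'
  have hρ := contDiffAt_isoRho (G := G) (n := n) hT ha ha'
  have hτ := contDiffAt_const_div (n := n) hT G.TA
  unfold charField
  fun_prop

end Smooth

section Line

variable {G} {ε : ℝ} {z : ℝ × ℝ × ℝ}

theorem hasDerivAt_line (z r : ℝ × ℝ × ℝ) : HasDerivAt (fun t : ℝ => z + t • r) r 0 := by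
  simpa using ((hasDerivAt_id (0 : ℝ)).smul_const r).const_add z

theorem fderiv_eq_of_hasDerivAt_line {F : Type*} [NormedAddCommGroup F] [NormedSpace ℝ F]
    {f : ℝ × ℝ × ℝ → F} {r : ℝ × ℝ × ℝ} {f' : F} (hf : DifferentiableAt ℝ f z)
    (h : HasDerivAt (fun t : ℝ => f (z + t • r)) f' 0) : fderiv ℝ f z r = f' := by
  have h0 : z + (0 : ℝ) • r = z := by simp
  have h1 : HasFDerivAt f (fderiv ℝ f z) (z + (0 : ℝ) • r) := by
    rw [h0]; exact hf.hasFDerivAt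
  exact (h1.comp_hasDerivAt (0 : ℝ) (hasDerivAt_line z r)).unique h

/-- The curves `T` and `a` along the line through `z` in the characteristic direction. -/
theorem hasDerivAt_line_coords (ε : ℝ) (z : ℝ × ℝ × ℝ) :
    HasDerivAt (fun t : ℝ => (z + t • G.charField ε z).1) z.1 0 ∧
    HasDerivAt (fun t : ℝ => (z + t • G.charField ε z).2.1)
      (z.2.1 * (1 - z.2.1) * (G.TA / z.1 - G.isoSlope z.1 z.2.1)) 0 ∧
    HasDerivAt (fun t : ℝ => (z + t • G.charField ε z).2.2)
      (ε * G.soundSpeed z.1 z.2.1 * (G.v z.1 z.2.1 * G.isoRho z.1 z.2.1)) 0 := by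
  have h := hasDerivAt_line z (G.charField ε z)
  exact ⟨h.fst, h.snd.fst, h.snd.snd⟩

/-- With `c` the characteristic speed, the field satisfies `dv = -v q`, `du = c v q`, `dp = p r`,
`de = p v q`. The first component balances at once; the other two reduce to `c² v q = p r`, that is
`c² = -dp/dv`. -/
theorem fderiv_flux (hε : ε ^ 2 = 1) (hT : 0 < z.1) (ha : 0 < z.2.1) (ha' : z.2.1 < 1)
    (hr : 0 < G.isoP z.1 z.2.1) (hq : 0 < G.isoRho z.1 z.2.1) :
    fderiv ℝ G.flux z (G.charField ε z) = (ε * G.soundSpeed z.1 z.2.1) •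
      fderiv ℝ G.density z (G.charField ε z) := by
  have hp0 := G.p_pos hT ha ha'
  have hv0 := G.v_pos hT ha ha'
  have hsq : (ε * G.soundSpeed z.1 z.2.1) ^ 2 * (G.v z.1 z.2.1 * G.isoRho z.1 z.2.1) =
      G.p z.1 z.2.1 * G.isoP z.1 z.2.1 := by
    rw [mul_pow, hε, soundSpeed, Real.sq_sqrt (by positivity)]
    field_simp
  have hp := contDiffAt_p (G := G) (n := 1) hT ha ha'
  have hv := contDiffAt_v (G := G) (n := 1) hT ha ha'
  have he := contDiffAt_e (G := G) (n := 1) hT ha ha'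
  have hflux : DifferentiableAt ℝ G.flux z := by
    have : ContDiffAt ℝ 1 G.flux z := by unfold flux; fun_prop
    exact this.differentiableAt one_ne_zero
  have hdens : DifferentiableAt ℝ G.density z := by
    have : ContDiffAt ℝ 1 G.density z := by unfold density; fun_prop
    exact this.differentiableAt one_ne_zero
  obtain ⟨hT', ha1', hu'⟩ := hasDerivAt_line_coords (G := G) ε z
  set c := ε * G.soundSpeed z.1 z.2.1 with hc
  set T := fun t : ℝ => (z + t • G.charField ε z).1 with hTdef
  set a := fun t : ℝ => (z + t • G.charField ε z).2.1 with hadef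
  set u := fun t : ℝ => (z + t • G.charField ε z).2.2 with hudef
  have hT0 : T 0 = z.1 := by simp [T]
  have ha0 : a 0 = z.2.1 := by simp [a]
  have hu0 : u 0 = z.2.2 := by simp [u]
  have hTa : HasDerivAt T (T 0) 0 ∧ 0 < T 0 ∧ 0 < a 0 ∧ a 0 < 1 ∧
      HasDerivAt a (a 0 * (1 - a 0) * (G.TA / T 0 - G.isoSlope (T 0) (a 0))) 0 := by
    rw [hT0, ha0]
    exact ⟨hT', hT, ha, ha', ha1'⟩
  obtain ⟨k1, k2, k3, k4, k5⟩ := hTa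
  have Dp := hasDerivAt_p k1 k2 k3 k4 k5
  have Dv := hasDerivAt_v k1 k2 k3 k4 k5
  have De := hasDerivAt_e k1 k2 k3 k4 k5
  rw [hT0, ha0] at Dp Dv De
  have Dflux : HasDerivAt (fun t : ℝ => G.flux (z + t • G.charField ε z)) _ 0 :=
    hu'.neg.prodMk (Dp.prodMk (Dp.mul hu'))
  have Ddens : HasDerivAt (fun t : ℝ => G.density (z + t • G.charField ε z)) _ 0 :=
    Dv.prodMk (hu'.prodMk (De.add ((hu'.pow 2).div_const 2)))
  rw [fderiv_eq_of_hasDerivAt_line hflux Dflux, fderiv_eq_of_hasDerivAt_line hdens Ddens]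
  simp only [Prod.smul_mk, smul_eq_mul, Prod.mk.injEq]
  rw [hT0, ha0]
  refine ⟨by ring, by linear_combination -hsq, ?_⟩
  push_cast
  linear_combination (-u 0) * hsq

/-- Half the logarithmic derivative of `p r / (v q)`, where `p' / p = r` and `v' / v = -q`. -/
theorem hasDerivAt_soundSpeed {T a : ℝ → ℝ} {s r' q' : ℝ} (hT : HasDerivAt T (T s) s)
    (hT0 : 0 < T s) (ha0 : 0 < a s) (ha1 : a s < 1)
    (ha : HasDerivAt a (a s * (1 - a s) * (G.TA / T s - G.isoSlope (T s) (a s))) s)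
    (hr : 0 < G.isoP (T s) (a s)) (hq : 0 < G.isoRho (T s) (a s))
    (hr' : HasDerivAt (fun t => G.isoP (T t) (a t)) r' s)
    (hq' : HasDerivAt (fun t => G.isoRho (T t) (a t)) q' s) :
    HasDerivAt (fun t => G.soundSpeed (T t) (a t))
      (G.soundSpeed (T s) (a s) / 2 * (G.isoP (T s) (a s) + G.isoRho (T s) (a s) +
        r' / G.isoP (T s) (a s) - q' / G.isoRho (T s) (a s))) s := by
  have hp0 := G.p_pos hT0 ha0 ha1
  have hv0 := G.v_pos hT0 ha0 ha1
  have Dp := hasDerivAt_p hT hT0 ha0 ha1 ha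
  have Dv := hasDerivAt_v hT hT0 ha0 ha1 ha
  have hL0 : 0 < G.p (T s) (a s) * G.isoP (T s) (a s) /
    (G.v (T s) (a s) * G.isoRho (T s) (a s)) := by positivity
  have hsq := Real.sq_sqrt hL0.le
  have hc0 := Real.sqrt_pos.2 hL0
  refine (((Dp.mul hr').div (Dv.mul hq') (mul_pos hv0 hq).ne').sqrt hL0.ne').congr_deriv ?_
  simp only [Pi.div_apply, Pi.mul_apply]
  unfold soundSpeed
  generalize √(G.p (T s) (a s) * G.isoP (T s) (a s) /
    (G.v (T s) (a s) * G.isoRho (T s) (a s))) = c at *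
  rw [div_eq_iff (by positivity)]
  calc _ = c ^ 2 * (G.isoP (T s) (a s) + G.isoRho (T s) (a s) +
        r' / G.isoP (T s) (a s) - q' / G.isoRho (T s) (a s)) := by
        rw [hsq]
        field_simp
        ring
    _ = _ := by ring

end Line

/-- A state at which the sound speed increases along the isentropes in the direction of increasing
temperature belongs to the genuinely nonlinear region. -/
theorem mem_genuinelyNonlinearRegion {T a : ℝ} (hT : 0 < T) (ha : 0 < a) (ha' : a < 1)
    (hr : 0 < G.isoP T a) (hq : 0 < G.isoRho T a)
    (h : ∀ θ c : ℝ → ℝ, θ 0 = T → c 0 = a → HasDerivAt θ T 0 →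
      HasDerivAt c (a * (1 - a) * (G.TA / T - G.isoSlope T a)) 0 →
      ∃ r' q' : ℝ, HasDerivAt (fun t => G.isoP (θ t) (c t)) r' 0 ∧
        HasDerivAt (fun t => G.isoRho (θ t) (c t)) q' 0 ∧
        0 < G.isoP T a + G.isoRho T a + r' / G.isoP T a - q' / G.isoRho T a) :
    (T, a) ∈ G.genuinelyNonlinearRegion := by
  have hp0 := G.p_pos hT ha ha'
  have hv0 := G.v_pos hT ha ha'
  have hsound : 0 < G.soundSpeed T a := Real.sqrt_pos.2 (by positivity)
  have key : ∀ (u ε : ℝ), ε ^ 2 = 1 →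
      G.IsCharacteristicFieldAt (fun z => ε * G.soundSpeed z.1 z.2.1) (G.charField ε) (T, a, u) ∧
      fderiv ℝ (fun z : ℝ × ℝ × ℝ => ε * G.soundSpeed z.1 z.2.1) (T, a, u)
        (G.charField ε (T, a, u)) ≠ 0 := by
    intro u ε hε
    have hlam : ContDiffAt ℝ 1 (fun z : ℝ × ℝ × ℝ => ε * G.soundSpeed z.1 z.2.1) (T, a, u) :=
      contDiffAt_const.mul (contDiffAt_soundSpeed (w := (T, a, u)) hT ha ha' hr hq)
    refine ⟨⟨hlam, contDiffAt_charField (w := (T, a, u)) ε hT ha ha' hr hq, ?_⟩, ?_⟩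
    · have c1 : ContinuousAt (fun z : ℝ × ℝ × ℝ => z.1) (T, a, u) := by fun_prop
      have c2 : ContinuousAt (fun z : ℝ × ℝ × ℝ => z.2.1) (T, a, u) := by fun_prop
      have c3 := (contDiffAt_isoP (G := G) (n := 1) (w := (T, a, u)) hT ha ha').continuousAt
      have c4 := (contDiffAt_isoRho (G := G) (n := 1) (w := (T, a, u)) hT ha ha').continuousAt
      filter_upwards [c1.eventually (lt_mem_nhds hT), c2.eventually (lt_mem_nhds ha),
        c2.eventually (gt_mem_nhds ha'), c3.eventually (lt_mem_nhds hr),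
        c4.eventually (lt_mem_nhds hq)] with z h1 h2 h3 h4 h5
      refine ⟨fun h0 => ?_, fderiv_flux hε h1 h2 h3 h4 h5⟩
      exact h1.ne' (congrArg Prod.fst h0)
    -- Differentiating `λ` in the direction of the field only needs the straight line, whose
    -- first-order behaviour is that of the isentrope.
    · obtain ⟨hT', ha1', -⟩ := hasDerivAt_line_coords (G := G) ε (T, a, u)
      set θ := fun t : ℝ => ((T, a, u) + t • G.charField ε (T, a, u)).1 with hθ
      set c := fun t : ℝ => ((T, a, u) + t • G.charField ε (T, a, u)).2.1 with hc
      have hT0 : θ 0 = T := by simp [θ]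
      have ha0 : c 0 = a := by simp [c]
      obtain ⟨r', q', Dr, Dq, hpos⟩ := h θ c hT0 ha0 hT' ha1'
      have hs : HasDerivAt (fun t => G.soundSpeed (θ t) (c t)) (G.soundSpeed T a / 2 *
          (G.isoP T a + G.isoRho T a + r' / G.isoP T a - q' / G.isoRho T a)) 0 := by
        have := hasDerivAt_soundSpeed (G := G) (T := θ) (a := c) (s := 0) (r' := r') (q' := q')
        rw [hT0, ha0] at this
        exact this hT' hT ha ha' ha1' hr hq Dr Dq
      rw [fderiv_eq_of_hasDerivAt_line (hlam.differentiableAt one_ne_zero) (hs.const_mul ε)]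
      have hε0 : ε ≠ 0 := fun h0 => by simp [h0] at hε
      positivity
  refine ⟨hT, ha, ha', fun u => ⟨?_, ?_⟩⟩
  · obtain ⟨h1, h2⟩ := key u 1 (by norm_num)
    exact ⟨_, _, h1, by simpa using hsound, h2⟩
  · obtain ⟨h1, h2⟩ := key u (-1) (by norm_num)
    exact ⟨_, _, h1, by simpa using hsound, h2⟩

end IonizedMixture

/-! ### The Hugoniot locus -/

namespace IonizedMixture

open Isentrope

variable (G : IonizedMixture)

/-- On the Hugoniot locus of a state with the temperature `TR ≤ T`, the pressure ratio `p₊ / p` is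
at most the temperature ratio `TR / T`. -/
theorem hugoniot_ratio_le_one {t x y Pi : ℝ} (ht : 1 ≤ t) (hx : 0 ≤ x) (hy : 0 ≤ y) (hPi : 0 < Pi)
    (h : t * (1 + x) * (4 + Pi) + y = 4 + Pi⁻¹) : t * Pi ≤ 1 := by
  have h1 : t * (4 + Pi) ≤ 4 + Pi⁻¹ := by
    have : 0 ≤ t * x * (4 + Pi) := by positivity
    linarith
  have h2 : t * (4 + Pi) * Pi ≤ 4 * Pi + 1 := by
    calc t * (4 + Pi) * Pi ≤ (4 + Pi⁻¹) * Pi := by gcongr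
      _ = 4 * Pi + 1 := by field_simp
  have h3 : Pi ≤ 1 := by
    by_contra hc
    push Not at hc
    have : 1 * (4 + Pi) * Pi ≤ t * (4 + Pi) * Pi := by gcongr
    nlinarith
  have h4 : t * Pi * (4 + Pi) ≤ 1 * (4 + Pi) := by nlinarith
  exact le_of_mul_le_mul_right h4 (by positivity)

/-- Squaring the quantity bounded by `σ` cancels `p₊`, `T₊` and the exponential in the pressure
ratio. The exponent `-9/4` is the one for which the remaining powers combine: `3/2 + 9/2 = 6`, the
square of a cube of `T_A / T`. -/
theorem pressureRatio_mul_sq {pR TR T a : ℝ} (hp : 0 < pR) (hTR : 0 < TR) (hT : 0 < T)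
    (ha : 0 < a) (ha' : a < 1) :
    (1 - a) * (1 + G.alpha T a) * (T / TR * G.pressureRatio pR TR T a) *
      (Real.sqrt (G.β * TR * G.TA ^ (3 / 2 : ℝ) / (G.μA * pR)) * (T / G.TA) ^ (-(9 / 4) : ℝ) *
        Real.exp (-G.TA / (2 * T))) ^ 2 = G.β * a * G.alpha T a * (G.TA / T) ^ 6 := by
  have hβ := G.β_pos
  have hμ := G.μA_pos
  have hTA := G.TA_pos
  have hx := G.alpha_pos (T := T) ha ha'
  have h1a : 0 < 1 - a := sub_pos.2 ha'
  have hexp : Real.exp (-G.TA / (2 * T)) ^ 2 = (Real.exp (G.TA / T))⁻¹ := by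
    rw [← Real.exp_nat_mul, ← Real.exp_neg]
    congr 1
    push_cast
    field_simp
  have hN : ((T / G.TA) ^ (-(9 / 4) : ℝ)) ^ 2 = (G.TA / T) ^ (9 / 2 : ℝ) := by
    rw [← Real.rpow_natCast, ← Real.rpow_mul (by positivity), ← inv_div G.TA T,
      Real.inv_rpow (by positivity), ← Real.rpow_neg (by positivity)]
    norm_num
  have h6 : G.TA ^ (3 / 2 : ℝ) / T ^ (3 / 2 : ℝ) * (G.TA / T) ^ (9 / 2 : ℝ) = (G.TA / T) ^ 6 := by
    rw [← Real.div_rpow hTA.le hT.le, ← Real.rpow_add (by positivity), ← Real.rpow_natCast]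
    norm_num
  have h52 : T ^ (5 / 2 : ℝ) = T ^ (3 / 2 : ℝ) * T := by
    rw [← Real.rpow_add_one hT.ne']
    norm_num
  have hA3 : 0 < G.TA ^ (3 / 2 : ℝ) := Real.rpow_pos_of_pos hTA _
  have hT3 : 0 < T ^ (3 / 2 : ℝ) := Real.rpow_pos_of_pos hT _
  have hR5 : 0 < TR ^ (5 / 2 : ℝ) := Real.rpow_pos_of_pos hTR _
  have hE := Real.exp_pos (G.TA / T)
  rw [mul_pow, mul_pow, Real.sq_sqrt (by positivity), hexp, hN, ← h6, pressureRatio,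
    Real.div_rpow hTR.le hT.le, h52]
  generalize (G.TA / T) ^ (9 / 2 : ℝ) = N
  generalize G.alpha T a = x at *
  field_simp

/-- The degree of ionization of A on the Hugoniot locus. -/
theorem cube_le_of_mem_approxHugoniot {σ pR TR T a : ℝ} (hσ : 0 < σ) (hp : 0 < pR) (hTR : 0 < TR)
    (hT : TR ≤ T)
    (hle : Real.sqrt (G.β * TR * G.TA ^ (3 / 2 : ℝ) / (G.μA * pR)) *
      (T / G.TA) ^ (-(9 / 4) : ℝ) * Real.exp (-G.TA / (2 * T)) ≤ σ)
    (h : (T, a) ∈ G.approxHugoniot pR TR) :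
    G.β * a * (G.TA / T) ^ 3 ≤ σ * (1 + G.alpha T a) := by
  obtain ⟨hT0, ha, ha', heq⟩ := h
  dsimp only at hT0 ha ha' heq
  have hβ := G.β_pos
  have hβ1 := sub_nonneg.2 G.β_le_one
  have hTA := G.TA_pos
  have hTB := hTA.trans G.TA_lt_TB
  have hμ := G.μA_pos
  have hx := G.alpha_pos (T := T) ha ha'
  have hb := G.alphaB_pos (T := T) ha ha'
  have h1a : 0 < 1 - a := sub_pos.2 ha'
  have hPi : 0 < G.pressureRatio pR TR T a := by
    unfold pressureRatio
    positivity
  have h1 : T / TR * G.pressureRatio pR TR T a ≤ 1 :=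
    hugoniot_ratio_le_one ((one_le_div hTR).2 hT) hx.le (by positivity) hPi heq
  have h2 := G.pressureRatio_mul_sq hp hTR hT0 ha ha'
  -- Replacing `α` by `β a` turns the right-hand side of `h2` into a perfect square.
  have h3 : G.β * a ≤ G.alpha T a := le_add_of_nonneg_right (by positivity)
  refine le_of_sq_le_sq ?_ (by positivity)
  calc (G.β * a * (G.TA / T) ^ 3) ^ 2 = G.β * a * (G.β * a) * (G.TA / T) ^ 6 := by ring
    _ ≤ G.β * a * G.alpha T a * (G.TA / T) ^ 6 := by gcongr
    _ ≤ 1 * (1 + G.alpha T a) * 1 * σ ^ 2 := by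
      rw [← h2]
      gcongr
      linarith
    _ ≤ (σ * (1 + G.alpha T a)) ^ 2 := by nlinarith [sq_pos_of_pos hσ]

/-- The exponential decay in `T_A / T` outweighs the cube of `T_A / T`, which makes the third moment
of gas B negligible at low temperature. -/
theorem alphaB_le {T a : ℝ} (ha : 0 < a) (ha' : a ≤ 1 / 2) :
    G.alphaB T a ≤ 2 * (G.μA / G.μB) * a * Real.exp (-((G.TB - G.TA) / G.TA * (G.TA / T))) := by
  have h1 := G.μA_pos
  have h2 := G.μB_pos
  have hTA := G.TA_pos.ne'
  have e : -((G.TB - G.TA) / G.TA * (G.TA / T)) = -(G.TB - G.TA) / T := by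
    field_simp
  rw [e, alphaB]
  have hE := Real.exp_pos (-(G.TB - G.TA) / T)
  generalize Real.exp (-(G.TB - G.TA) / T) = E at *
  have h3 : 1 / 2 ≤ 1 - a := by linarith
  have h4 : 0 < G.μB * (1 - a) := mul_pos h2 (by linarith)
  calc G.μA * a * E / (G.μA * a * E + G.μB * (1 - a)) ≤ G.μA * a * E / (G.μB * (1 / 2)) := by
        gcongr
        have : G.μB * (1 / 2) ≤ G.μB * (1 - a) := by gcongr
        have : 0 < G.μA * a * E := by positivity
        linarith
    _ = _ := by field_simp

theorem mem_genuinelyNonlinearRegion_of_weakIonization {η T a : ℝ} (hT : 0 < T)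
    (h : WeakIonization η (G.β * a) ((1 - G.β) * G.alphaB T a) a (G.alphaB T a)
      (G.TA / T) (G.TB / T))
    (h60 : G.β * a * (G.TA / T) ^ 3 ≤ 60 - 300000 * η) :
    (T, a) ∈ G.genuinelyNonlinearRegion := by
  have ha := h.a_pos
  have ha' : a < 1 := by linarith [h.a_le, h.η_le]
  have key : ∀ θ c : ℝ → ℝ, θ 0 = T → c 0 = a → HasDerivAt θ T 0 →
      HasDerivAt c (a * (1 - a) * (G.TA / T - G.isoSlope T a)) 0 →
      0 < G.isoP T a ∧ 0 < G.isoRho T a ∧ ∃ r' q' : ℝ,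
        HasDerivAt (fun t => G.isoP (θ t) (c t)) r' 0 ∧
        HasDerivAt (fun t => G.isoRho (θ t) (c t)) q' 0 ∧
        0 < G.isoP T a + G.isoRho T a + r' / G.isoP T a - q' / G.isoRho T a := by
    intro θ c hθ hc Dθ Dc
    subst hθ hc
    exact WeakIonization.exists_hasDerivAt_pos (a := c) (b := fun t => G.alphaB (θ t) (c t))
      (τ := fun t => G.TA / θ t) (κ := fun t => G.TB / θ t) G.β_pos G.β_le_one h h60 Dc
      (hasDerivAt_alphaB Dθ hT ha ha' Dc) (hasDerivAt_const_div Dθ hT.ne' _)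
      (hasDerivAt_const_div Dθ hT.ne' _)
  -- The positivity of `isoP` and `isoRho` does not depend on the curve; a straight line serves to
  -- extract it.
  obtain ⟨hr, hq, -⟩ := key (fun t => T + t * T)
    (fun t => a + t * (a * (1 - a) * (G.TA / T - G.isoSlope T a))) (by simp) (by simp)
    (by simpa using ((hasDerivAt_id (0 : ℝ)).mul_const T).const_add T)
    (by simpa using ((hasDerivAt_id (0 : ℝ)).mul_const
      (a * (1 - a) * (G.TA / T - G.isoSlope T a))).const_add a)
  exact G.mem_genuinelyNonlinearRegion hT ha ha' hr hq
    fun θ c h1 h2 h3 h4 => (key θ c h1 h2 h3 h4).2.2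

end IonizedMixture

end

/-! ### Choice of the constants -/

theorem mainTheorem10 (G : IonizedMixture) (σ : ℝ) (hσ : 0 < σ) (hσ60 : σ < 60) :
    ∃ δ : ℝ, 0 < δ ∧ ∀ pR TR T a : ℝ, 0 < pR → 0 < TR → TR ≤ T →
      Real.sqrt (G.β * TR * G.TA ^ (3 / 2 : ℝ) / (G.μA * pR)) * (T / G.TA) ^ (-(9 / 4) : ℝ) *
        Real.exp (-G.TA / (2 * T)) ≤ σ →
      (T, a) ∈ G.approxHugoniot pR TR → a < δ → G.alphaB T a < δ →
      (T, a) ∈ G.genuinelyNonlinearRegion := by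
  have hβ := G.β_pos
  have hβ1 := sub_nonneg.2 G.β_le_one
  have hTA := G.TA_pos
  have hTAB := G.TA_lt_TB
  have hμA := G.μA_pos
  have hμB := G.μB_pos
  -- Thus `60 - σ = 60000000 η`, which makes `σ + 60 η ≤ 60 - 300000 η` and `η ≤ 1 / 1000000`.
  obtain ⟨η, hη⟩ : ∃ η, η = (60 - σ) / 60000000 := ⟨_, rfl⟩
  have hη0 : 0 < η := by rw [hη]; apply div_pos <;> linarith
  have hη1 : η ≤ 1 / 1000000 := by rw [hη]; linarith
  have hc : 0 < (G.TB - G.TA) / G.TA := div_pos (sub_pos.2 hTAB) hTA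
  obtain ⟨τ₁, hτ₁⟩ : ∃ τ₁ : ℝ, ∀ τ ≥ τ₁, 2 * (G.μA / G.μB) * (60 / G.β) *
      Real.exp (-((G.TB - G.TA) / G.TA * τ)) ≤ η := by
    have h1 : Tendsto (fun τ : ℝ => 2 * (G.μA / G.μB) * (60 / G.β) *
        Real.exp (-((G.TB - G.TA) / G.TA * τ))) atTop (𝓝 (2 * (G.μA / G.μB) * (60 / G.β) * 0)) :=
      (Real.tendsto_exp_neg_atTop_nhds_zero.comp (tendsto_id.const_mul_atTop hc)).const_mul _
    rw [mul_zero] at h1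
    exact eventually_atTop.1 (h1.eventually (ge_mem_nhds hη0))
  -- Beyond `τ₁` the third moment of gas B is at most `η`, given `a τ³ ≤ 60 / β`. Beyond `120 / η` a
  -- bounded third moment makes the second moment at most `η`.
  obtain ⟨τ₀, hτ₀, hτ₀'⟩ : ∃ τ₀ : ℝ, τ₁ ≤ τ₀ ∧ 120 / η ≤ τ₀ :=
    ⟨max τ₁ (120 / η), le_max_left _ _, le_max_right _ _⟩
  have hτ₀2 : 2 ≤ τ₀ := by
    refine le_trans ?_ hτ₀'
    rw [le_div_iff₀ hη0]
    linarith
  have hτ₀1 : 1 ≤ τ₀ := by linarith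
  have hδ0 : 0 < η / τ₀ ^ 3 := by positivity
  have hδη : η / τ₀ ^ 3 ≤ η := div_le_self hη0.le (one_le_pow₀ hτ₀1)
  refine ⟨η / τ₀ ^ 3, hδ0, fun pR TR T a hp hTR hT hle h haδ hbδ => ?_⟩
  have h3 := G.cube_le_of_mem_approxHugoniot hσ hp hTR hT hle h
  obtain ⟨hT0, ha, ha', -⟩ := h
  dsimp only at hT0 ha ha'
  have hb := G.alphaB_pos (T := T) ha ha'
  have hbE := G.alphaB_le (T := T) ha (by linarith)
  have hxδ : G.alpha T a ≤ η / τ₀ ^ 3 := by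
    calc G.alpha T a ≤ G.β * (η / τ₀ ^ 3) + (1 - G.β) * (η / τ₀ ^ 3) := by
          unfold IonizedMixture.alpha
          gcongr
      _ = η / τ₀ ^ 3 := by ring
  have hx0 := G.alpha_pos (T := T) ha ha'
  have hxdef : G.alpha T a = G.β * a + (1 - G.β) * G.alphaB T a := rfl
  have hκ : G.TB / T ≤ 2 * (G.TA / T) := by
    rw [← mul_div_assoc]
    have := G.TB_le
    gcongr
  have hτκ : G.TA / T ≤ G.TB / T := by gcongr
  have hτ : 0 < G.TA / T := by positivity
  have hQb : (1 - G.β) * G.alphaB T a ≤ G.alphaB T a := by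
    have : 0 ≤ G.β * G.alphaB T a := by positivity
    linarith
  generalize hτdef : G.TA / T = τ at *
  have h60 : G.β * a * τ ^ 3 ≤ 60 - 300000 * η := by
    have : σ * G.alpha T a ≤ 60 * η := by
      have := hxδ.trans hδη
      gcongr
    linarith
  have h60' : G.β * a * τ ^ 3 ≤ 60 := by linarith
  -- For `τ ≤ τ₀` the bound `η / τ₀ ^ 3` on the degrees of ionization absorbs all powers up to the
  -- third. For `τ > τ₀` the Hugoniot bound `β a τ³ ≤ 60` takes over.
  have hsmall : G.alpha T a * τ ^ 2 ≤ η ∧ (1 - G.β) * G.alphaB T a * τ ^ 3 ≤ η := by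
    rcases le_or_gt τ τ₀ with hcase | hcase
    · constructor
      · calc G.alpha T a * τ ^ 2 ≤ η / τ₀ ^ 3 * τ₀ ^ 2 := by gcongr
          _ ≤ η / τ₀ ^ 3 * τ₀ ^ 3 := by
            gcongr
            norm_num
          _ = η := by field_simp
      · calc (1 - G.β) * G.alphaB T a * τ ^ 3 ≤ η / τ₀ ^ 3 * τ₀ ^ 3 := by
              gcongr
              linarith
          _ = η := by field_simp
    · have hQ3 : (1 - G.β) * G.alphaB T a * τ ^ 3 ≤ η := by
        refine le_trans ?_ (hτ₁ τ (by linarith))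
        have e1 : a * τ ^ 3 ≤ 60 / G.β := by
          rw [le_div_iff₀ hβ]
          linarith
        calc (1 - G.β) * G.alphaB T a * τ ^ 3
            ≤ 2 * (G.μA / G.μB) * a * Real.exp (-((G.TB - G.TA) / G.TA * τ)) * τ ^ 3 := by
              exact mul_le_mul_of_nonneg_right (hQb.trans hbE) (by positivity)
          _ = 2 * (G.μA / G.μB) * (a * τ ^ 3) * Real.exp (-((G.TB - G.TA) / G.TA * τ)) := by ring
          _ ≤ _ := by gcongr
      refine ⟨?_, hQ3⟩
      have e1 : 120 ≤ η * τ := by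
        rw [div_le_iff₀ hη0] at hτ₀'
        have : τ₀ * η ≤ τ * η := by gcongr
        linarith
      have e2 : η * 2 ≤ η * τ := by
        gcongr
        linarith
      refine le_of_mul_le_mul_right ?_ hτ
      rw [hxdef]
      have e3 : (G.β * a + (1 - G.β) * G.alphaB T a) * τ ^ 2 * τ =
        G.β * a * τ ^ 3 + (1 - G.β) * G.alphaB T a * τ ^ 3 := by ring
      rw [e3]
      linarith
  have hzero : G.alpha T a ≤ η := hxδ.trans hδη
  refine G.mem_genuinelyNonlinearRegion_of_weakIonization (η := η) hT0 ?_ (by rwa [hτdef])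
  rw [hτdef]
  exact
    { η_pos := hη0
      η_le := hη1
      P_pos := by positivity
      Q_nonneg := by positivity
      a_pos := ha
      b_pos := hb
      τ_pos := hτ
      τ_le := hτκ
      κ_le := hκ
      a_le := by linarith
      b_le := by linarith
      zeroth := hzero
      first := by
        rw [← hxdef]
        -- Since `2 τ ≤ 1 + τ²`, the first moment is at most the mean of the zeroth and the second.
        have : 0 ≤ G.alpha T a * (τ - 1) ^ 2 := by positivity
        linarith [hsmall.1]
      second := hsmall.1
      third := h60'
      Q_third := hsmall.2 }
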